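/- For positive integers $k,N$ let $U_{k,N}:\{0,1\}^{k\times N}\to\{0,1\}$ be the function that reads the rows of its input as $k$ binary numbers $x^{(1)},\dots,x^{(k)}\in\{0,\dots,2^N-1\}$ and outputs $1$ if and only if $x^{(1)}+\cdots+x^{(k)}\ge 2^N$ (if $k=0$ or $N=0$, it is the constant $0$). A monotone majority circuit is a finite directed acyclic graph, possibly with multiple edges (wires), whose input nodes are labeled by $0$, $1$ or a variable and whose other nodes are unweighted threshold gates, i.e. gates that output $1$ if and only if at least $t$ of their incoming wires carry a $1$, where $t$ may vary from gate to gate; its size is the number of wires and its depth is the largest number of gates on a path to the output. An $\mathsf{AND}/\mathsf{OR}/\mathsf{NOT}$ circuit has unbounded fan-in $\mathsf{AND}$ and $\mathsf{OR}$ gates and negations applied to the input variables only, and negations do not count towards its depth. "Depth $d$" means depth at most $d$. Theorem. There is an absolute constant $0<c<1$ such that, with $k(n)=\lfloor(\log_2 n)^c\rfloor$, the explicit functions $g_n=U_{k(n),n}$ have the following properties. (0) Each $g_n$ is monotone. (i) There is a polynomial $p$ such that every $g_n$ is computed by an $\mathsf{AND}/\mathsf{OR}/\mathsf{NOT}$ circuit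 of depth $3$ with at most $p(n)$ nodes and at most $p(n)$ wires. (ii) For every constant $d\ge 2$ there is $\delta>0$ such that for all sufficiently large $n$, every monotone majority circuit of depth $d$ that computes $g_n$ has size at least $2^{\delta n^{1/d}}$. The same three statements hold if $g_n$ is regarded as a function $\{0,1\}^{n\lfloor\log_2 n\rfloor}\to\{0,1\}$ of a matrix with $\lfloor\log_2 n\rfloor\ge k(n)$ rows of $n$ bits that ignores all rows after the first $k(n)$. -/

import Mathlib

open Filter

/-- A node of a circuit, sitting at position `m` of a topological order of the circuit: either an
input node carrying a label in `I`, or a gate of type `G` together with its list of incoming wires.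
Every wire comes from one of the `m` earlier nodes; repetitions (multiple wires between the same two
nodes) are allowed. -/
inductive CircuitNode (I G : Type) (m : ℕ) : Type
  | input (a : I) : CircuitNode I G m
  | gate (g : G) (wires : List (Fin m)) : CircuitNode I G m

/-- A circuit: a finite directed acyclic multigraph, with its nodes listed in a topological order,
and a designated output node. Nodes from which the output cannot be reached are tolerated: they
count for the size and influence neither the depth nor the computed function. -/
structure Circuit (I G : Type) : Type where
  numNodes : ℕ
  node : (v : Fin numNodes) → CircuitNode I G v
  output : Fin numNodes

namespace Circuit

variable {I G : Type}

/-- The Boolean value of the node `v`, given the values `inp` of the input labels and the semantics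
`op` of the gates. -/
def value (C : Circuit I G) (inp : I → Bool) (op : G → List Bool → Bool)
    (v : Fin C.numNodes) : Bool :=
  match C.node v with
  | .input a => inp a
  | .gate g ws => op g (ws.map fun (u : Fin v.val) => C.value inp op ⟨u, u.isLt.trans v.isLt⟩)
termination_by v.val
decreasing_by exact u.isLt

/-- The largest number of gates on a directed path ending in `v`. Input nodes have depth `0`. -/
def nodeDepth (C : Circuit I G) (v : Fin C.numNodes) : ℕ :=
  match C.node v with
  | .input _ => 0
  | .gate _ ws => (ws.map fun (u : Fin v.val) => C.nodeDepth ⟨u, u.isLt.trans v.isLt⟩).foldr max 0 + 1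
termination_by v.val
decreasing_by exact u.isLt

/-- The depth of a circuit is the depth of its output node. -/
def depth (C : Circuit I G) : ℕ := C.nodeDepth C.output

/-- The number of incoming wires of a node. -/
def inDegree (C : Circuit I G) (v : Fin C.numNodes) : ℕ :=
  match C.node v with
  | .input _ => 0
  | .gate _ ws => ws.length

/-- The size of a circuit: its number of wires, counted with multiplicity. -/
def size (C : Circuit I G) : ℕ := ∑ v, C.inDegree v

end Circuit

/-- Labels of the input nodes of a monotone circuit: `0`, `1` or a variable. -/
inductive MonotoneInput (ι : Type) : Type
  | const (b : Bool) : MonotoneInput ι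
  | var (i : ι) : MonotoneInput ι

/-- The value of an input label under the assignment `x`. -/
def MonotoneInput.value {ι : Type} (x : ι → Bool) : MonotoneInput ι → Bool
  | .const b => b
  | .var i => x i

/-- The monotone unweighted threshold gate: at least `t` of the incoming wires carry a `1`. -/
def thr (t : ℕ) (l : List Bool) : Bool := decide (t ≤ l.count true)

/-- Monotone majority circuits over the variables `ι`. The gate type `t : ℕ` is the threshold. -/
abbrev MajorityCircuit (ι : Type) : Type := Circuit (MonotoneInput ι) ℕ

/-- The monotone majority circuit `C` computes the Boolean function `f`. -/
def MajorityCircuit.Computes {ι : Type} (C : MajorityCircuit ι) (f : (ι → Bool) → Bool) : Prop :=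
  ∀ x, C.value (MonotoneInput.value x) thr C.output = f x

/-- Labels of the input nodes of an AND/OR/NOT circuit: `0`, `1`, a variable or a negated
variable. -/
inductive LiteralInput (ι : Type) : Type
  | const (b : Bool) : LiteralInput ι
  | pos (i : ι) : LiteralInput ι
  | neg (i : ι) : LiteralInput ι

/-- The value of a literal under the assignment `x`. -/
def LiteralInput.value {ι : Type} (x : ι → Bool) : LiteralInput ι → Bool
  | .const b => b
  | .pos i => x i
  | .neg i => !(x i)

/-- The two types of unbounded fan-in gates. -/
inductive AndOrGate : Type
  | and : AndOrGate
  | or : AndOrGate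

/-- The semantics of the AND and OR gates. -/
def AndOrGate.op : AndOrGate → List Bool → Bool
  | .and, l => l.all id
  | .or, l => l.any id

/-- Unbounded fan-in AND/OR/NOT circuits over the variables `ι`, in the usual normal form in which
negations are applied to input variables only (and are not counted in the depth). -/
abbrev AndOrNotCircuit (ι : Type) : Type := Circuit (LiteralInput ι) AndOrGate

/-- The AND/OR/NOT circuit `C` computes the Boolean function `f`. -/
def AndOrNotCircuit.Computes {ι : Type} (C : AndOrNotCircuit ι) (f : (ι → Bool) → Bool) : Prop :=
  ∀ x, C.value (LiteralInput.value x) AndOrGate.op C.output = f x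

/-- The sum of the `k` numbers whose `N`-bit binary representations are the rows of `x`, column `0`
holding the most significant bits. -/
def rowSum {k N : ℕ} (x : Fin k × Fin N → Bool) : ℕ :=
  ∑ j : Fin N, 2 ^ (N - (j.val + 1)) * ∑ i : Fin k, (x (i, j)).toNat

/-- The function `U_{k,N}`: do the `k` numbers of `N` bits add up to at least `2 ^ N`? -/
def addThreshold (k N : ℕ) (x : Fin k × Fin N → Bool) : Bool := decide (2 ^ N ≤ rowSum x)

/-- The number of rows `k = ⌊(log₂ n) ^ c⌋`. -/
noncomputable def numRows (c : ℝ) (n : ℕ) : ℕ := ⌊(Real.logb 2 n) ^ c⌋₊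

theorem numRows_le {c : ℝ} (hc0 : 0 < c) (hc1 : c < 1) (n : ℕ) : numRows c n ≤ Nat.log 2 n := by
  unfold numRows
  rcases Nat.lt_or_ge n 2 with h | h
  · have h0 : Real.logb 2 (n : ℝ) = 0 := by
      interval_cases n <;> simp
    rw [h0, Real.zero_rpow hc0.ne']
    simp
  · have h1 : 1 ≤ Real.logb 2 (n : ℝ) := by
      rw [Real.le_logb_iff_rpow_le one_lt_two (by positivity)]
      simpa using (by exact_mod_cast h : (2 : ℝ) ≤ (n : ℝ))
    calc ⌊(Real.logb 2 n) ^ c⌋₊ ≤ ⌊Real.logb 2 n⌋₊ :=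
          Nat.floor_le_floor (by simpa using Real.rpow_le_rpow_of_exponent_le h1 hc1.le)
      _ = Nat.log 2 n := by
          simpa using Real.natFloor_logb_natCast 2 n

/-- The function `U_{k,n}` with `k = ⌊(log₂ n) ^ c⌋`, viewed as a function of `n * ⌊log₂ n⌋`
variables, arranged in `⌊log₂ n⌋` rows: only the first `k` rows matter. -/
noncomputable def paddedAddThreshold {c : ℝ} (hc0 : 0 < c) (hc1 : c < 1) (n : ℕ)
    (x : Fin (Nat.log 2 n) × Fin n → Bool) : Bool :=
  addThreshold (numRows c n) n fun q => x (Fin.castLE (numRows_le hc0 hc1 n) q.1, q.2)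

/-! Lower bound. A circuit with at most `s` wires unfolds into a formula of fan-in at most `s`, so
at depth `e + 1` its output compares a threshold with the number of true functions in a list of at
most `s` functions of depth `e`. It is therefore enough to find coupled random inputs `Y`, with sum
exactly `2 ^ N`, and `Z`, with smaller sum, such that for each such list `Z` satisfies at least as
many functions as `Y` with positive probability (`not_mem_thresholdClass_of_hasFoolingPair`). Such
pairs are built by induction on `e`. The input is cut into `n` blocks and a block `i` is chosen at
random. The blocks before `i` are each one short of a carry. In `Y`, block `i` produces the carry
and everything after it is `0`; in `Z`, block `i` falls short by enough that everything after it can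
be `1`. Functions left undetermined by the first blocks profit from the trailing ones of `Z`, so `Y`
can win only if block `i` settles at least half of the undetermined functions, apart from rare
failures controlled by the previous level. By `card_filter_le_of_halving` this happens for about
`log s` blocks only. One level (`HasFoolingPair.succ`) turns the error `ε` into `8 * ε + Nat.size s
/ n` and multiplies the number of columns by about `n`; hence `d - 1` steps after the base case use
about `n ^ d` columns and require `log s` of order `n`. Upper bound. Reading columns from the most
significant one, track the deficit, i.e. what is still missing to reach the target, in units of the
current column. Once nonpositive it stays so, and once at least `k` it stays at least `k`, so only
small deficits matter. A small deficit can be recovered from the next `k` digits alone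
(`guessDeficit_eq`). The circuit guesses where the deficit vanishes and checks that neighbouring
local guesses agree; each check sees `k + 1` columns and is a short conjunction of clauses
(`deficit_nonpos_iff`). -/

/-! ### Threshold formulas and the unfolding of circuits. -/

/-- The functions computed by monotone threshold formulas of depth `e` with fan-in at most `s`. -/
def ThresholdClass (ι : Type) (s : ℕ) : ℕ → Set ((ι → Bool) → Bool)
  | 0 => {f | ∃ a : MonotoneInput ι, f = fun x => a.value x}
  | e + 1 => {f | ∃ (t : ℕ) (l : List ((ι → Bool) → Bool)), l.length ≤ s ∧
      (∀ g ∈ l, g ∈ ThresholdClass ι s e) ∧ f = fun x => thr t (l.map fun g => g x)}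

/-- The number of functions of the list `l` that are true at `x`. -/
def numTrue {ι : Type} (l : List ((ι → Bool) → Bool)) (x : ι → Bool) : ℕ :=
  (l.map fun g => (g x).toNat).sum

theorem thr_map_eq {ι : Type} (t : ℕ) (l : List ((ι → Bool) → Bool)) (x : ι → Bool) :
    thr t (l.map fun g => g x) = decide (t ≤ numTrue l x) := by
  have h : (l.map fun g => g x).count true = numTrue l x := by
    unfold numTrue
    induction l with
    | nil => rfl
    | cons g l ih => cases hg : g x <;> simp [hg, ih, add_comm]
  simp [thr, h]

theorem numTrue_mono {ι : Type} {l : List ((ι → Bool) → Bool)} (hl : ∀ g ∈ l, Monotone g) :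
    Monotone (numTrue l) := by
  intro x y hxy
  refine List.sum_le_sum fun g hg => ?_
  have := hl g hg hxy
  revert this
  cases g x <;> cases g y <;> simp

theorem ThresholdClass.monotone {ι : Type} {s e : ℕ} {f : (ι → Bool) → Bool}
    (hf : f ∈ ThresholdClass ι s e) : Monotone f := by
  induction e generalizing f with
  | zero =>
    obtain ⟨a, rfl⟩ := hf
    cases a with
    | const b => exact fun x y _ => le_rfl
    | var i => exact fun x y h => h i
  | succ e ih =>
    obtain ⟨t, l, -, hl, rfl⟩ := hf
    intro x y hxy
    have := numTrue_mono (fun g hg => ih (hl g hg)) hxy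
    simp only [thr_map_eq]
    intro h
    simp only [decide_eq_true_eq] at h ⊢
    omega

theorem ThresholdClass.subst {ι κ : Type} {s e : ℕ} {f : (ι → Bool) → Bool}
    (hf : f ∈ ThresholdClass ι s e) (τ : ι → MonotoneInput κ) :
    (fun y => f fun i => (τ i).value y) ∈ ThresholdClass κ s e := by
  induction e generalizing f with
  | zero =>
    obtain ⟨a, rfl⟩ := hf
    cases a with
    | const b => exact ⟨.const b, rfl⟩
    | var i => exact ⟨τ i, rfl⟩
  | succ e ih =>
    obtain ⟨t, l, hs, hl, rfl⟩ := hf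
    refine ⟨t, l.map fun g y => g fun i => (τ i).value y, by simpa using hs, ?_, ?_⟩
    · simp only [List.mem_map, forall_exists_index, and_imp, forall_apply_eq_imp_iff₂]
      exact fun g hg => ih (hl g hg)
    · simp [Function.comp_def]

theorem ThresholdClass.le_succ {ι : Type} {s e : ℕ} (hs : 1 ≤ s) {f : (ι → Bool) → Bool}
    (hf : f ∈ ThresholdClass ι s e) : f ∈ ThresholdClass ι s (e + 1) := by
  refine ⟨1, [f], by simpa using hs, by simpa using hf, ?_⟩
  funext x
  cases h : f x <;> simp [thr, h]

theorem ThresholdClass.mono {ι : Type} {s e e' : ℕ} (hs : 1 ≤ s) (h : e ≤ e')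
    {f : (ι → Bool) → Bool} (hf : f ∈ ThresholdClass ι s e) : f ∈ ThresholdClass ι s e' := by
  induction e', h using Nat.le_induction with
  | base => exact hf
  | succ m _ ih => exact ThresholdClass.le_succ hs ih

/-- Unfolding may blow up the formula exponentially, but only the fan-in is recorded, and a gate has
no more incoming wires than the whole circuit. -/
theorem Circuit.value_mem_thresholdClass {ι : Type} (C : MajorityCircuit ι) {s : ℕ} (hs : 1 ≤ s)
    (hC : C.size ≤ s) (v : Fin C.numNodes) :
    (fun x => C.value (MonotoneInput.value x) thr v) ∈ ThresholdClass ι s (C.nodeDepth v) := by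
  obtain ⟨m, hm⟩ := v
  induction m using Nat.strong_induction_on with
  | _ m ih =>
    have hdeg : C.inDegree ⟨m, hm⟩ ≤ s :=
      (Finset.single_le_sum (f := C.inDegree) (fun _ _ => Nat.zero_le _)
        (Finset.mem_univ _)).trans hC
    cases hnode : C.node ⟨m, hm⟩ with
    | input a =>
      have h1 : C.nodeDepth ⟨m, hm⟩ = 0 := by rw [Circuit.nodeDepth, hnode]
      rw [h1]
      refine ⟨a, ?_⟩
      funext x
      rw [Circuit.value, hnode]
    | gate t ws =>
      have h1 : C.nodeDepth ⟨m, hm⟩ =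
          (ws.map fun (u : Fin m) => C.nodeDepth ⟨u, u.isLt.trans hm⟩).foldr max 0 + 1 := by
        rw [Circuit.nodeDepth, hnode]
      rw [h1]
      refine ⟨t, ws.map fun (u : Fin m) x =>
        C.value (MonotoneInput.value x) thr ⟨u, u.isLt.trans hm⟩, ?_, ?_, ?_⟩
      · simpa [Circuit.inDegree, hnode] using hdeg
      · simp only [List.mem_map, forall_exists_index, and_imp, forall_apply_eq_imp_iff₂]
        intro u hu
        refine ThresholdClass.mono hs ?_ (ih u u.isLt (u.isLt.trans hm))
        exact List.le_max_of_le (List.mem_map.2 ⟨u, hu, rfl⟩) le_rfl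
      · funext x
        rw [Circuit.value, hnode]
        simp only [List.map_map, Function.comp_def]

/-! ### Fooling pairs and the arithmetic of carries between blocks. -/

/-- Replacing a random sample of `Y` by the coupled sample of `Z` decreases the number of true
functions in a short list of shallow threshold functions with probability at most `ε`. -/
def Fools {V Ω : Type} [Fintype Ω] (s e : ℕ) (ε : ℝ) (Y Z : Ω → V → Bool) : Prop :=
  ∀ l : List ((V → Bool) → Bool), l.length ≤ s → (∀ g ∈ l, g ∈ ThresholdClass V s e) →
    ((Finset.univ.filter fun o => numTrue l (Z o) < numTrue l (Y o)).card : ℝ) ≤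
      ε * Fintype.card Ω

/-- The weighted sum of the bits of `x`, the variable `v` having weight `2 ^ ex v`. -/
def weightedSum {V : Type} [Fintype V] (ex : V → ℕ) (x : V → Bool) : ℕ :=
  ∑ v, 2 ^ ex v * (x v).toNat

/-- There are coupled random inputs `Y`, `Z` with sums equal to `2 ^ N` and less than `2 ^ N`,
placed in `k` rows and `N` columns, which fool the threshold functions of depth `e`. -/
def HasFoolingPair (s e k N : ℕ) (ε : ℝ) : Prop :=
  ∃ (V Ω : Type) (_ : Fintype V) (_ : Fintype Ω) (_ : Nonempty Ω) (row ex : V → ℕ)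
    (Y Z : Ω → V → Bool), (∀ v, row v < k) ∧ (∀ v, ex v < N) ∧
    (∀ u v, row u = row v → ex u = ex v → u = v) ∧
    (∀ o, weightedSum ex (Y o) = 2 ^ N) ∧ (∀ o, weightedSum ex (Z o) < 2 ^ N) ∧
    Fools s e ε Y Z

theorem sum_fin_horner_succ (v : ℕ → ℕ) (C m : ℕ) :
    ∑ b : Fin (m + 1), 2 ^ (C * (m + 1 - 1 - b)) * v b =
      2 ^ C * (∑ b : Fin m, 2 ^ (C * (m - 1 - b)) * v b) + v m := by
  rw [Fin.sum_univ_castSucc, Finset.mul_sum]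
  congr 1
  · refine Finset.sum_congr rfl fun b _ => ?_
    rw [← mul_assoc, ← pow_add]
    congr 2
    have : m + 1 - 1 - (b : ℕ) = (m - 1 - b) + 1 := by have := b.isLt; omega
    simp only [Fin.val_castSucc, this]
    ring
  · simp

theorem sum_fin_horner_prefix {v : ℕ → ℕ} {C m : ℕ} (h : ∀ b < m, v b + 1 = 2 ^ C) :
    ∑ b : Fin m, 2 ^ (C * (m - 1 - b)) * v b + 1 = 2 ^ (C * m) := by
  induction m with
  | zero => simp
  | succ m ih =>
    have h1 := ih fun b hb => h b (by omega)
    have h2 := h m (by omega)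
    rw [sum_fin_horner_succ, mul_add, pow_add, ← h1, mul_one, ← h2]
    ring

/-- The prefix is one short of `2 ^ (C * i)`; the digit `2 ^ C` supplies the missing unit, and zeros
keep equality. -/
theorem sum_fin_horner_eq {v : ℕ → ℕ} {C m i : ℕ} (hi : i < m) (h : ∀ b < i, v b + 1 = 2 ^ C)
    (hv : v i = 2 ^ C) (h0 : ∀ b, i < b → v b = 0) :
    ∑ b : Fin m, 2 ^ (C * (m - 1 - b)) * v b = 2 ^ (C * m) := by
  induction m, hi using Nat.le_induction with
  | base =>
    have h1 := sum_fin_horner_prefix h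
    rw [sum_fin_horner_succ, hv, Nat.succ_eq_add_one, mul_add, pow_add, ← h1]
    ring
  | succ m hm ih =>
    rw [sum_fin_horner_succ, ih, h0 m (by omega), mul_add, pow_add]
    ring

/-- A shortfall of at least `K` persists: the next block multiplies it by `2 ^ C` and then removes
at most `K * 2 ^ C - K`. -/
theorem sum_fin_horner_add_le {v : ℕ → ℕ} {C m i K : ℕ} (hi : i < m)
    (h : ∀ b < i, v b + 1 = 2 ^ C) (hv : v i + K ≤ 2 ^ C) (h0 : ∀ b, i < b → v b + K ≤ K * 2 ^ C) :
    ∑ b : Fin m, 2 ^ (C * (m - 1 - b)) * v b + K ≤ 2 ^ (C * m) := by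
  induction m, hi using Nat.le_induction with
  | base =>
    have h1 := sum_fin_horner_prefix h
    rw [sum_fin_horner_succ, Nat.succ_eq_add_one, mul_add, pow_add, ← h1, mul_one]
    linarith
  | succ m hm ih =>
    have := h0 m (by omega)
    rw [sum_fin_horner_succ, mul_add, pow_add, mul_one]
    linarith [Nat.mul_le_mul_left (2 ^ C) ih]

/-! ### The halving argument and the fooling pair for depth zero. -/

/-- The halving argument: a nonincreasing sequence of natural numbers cannot be halved more than
`Nat.size (A 0)` times. -/
theorem card_filter_le_of_halving {n : ℕ} (A : ℕ → ℕ) (bad exc : Fin n → Prop)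
    [DecidablePred bad] [DecidablePred exc] (hA : ∀ i, A (i + 1) ≤ A i)
    (h : ∀ i : Fin n, bad i → ¬ exc i → 0 < A i ∧ 2 * A (i + 1) ≤ A i) :
    (Finset.univ.filter bad).card ≤ (Finset.univ.filter exc).card + Nat.size (A 0) := by
  suffices H : (Finset.univ.filter bad).card + Nat.size (A n) ≤
      (Finset.univ.filter exc).card + Nat.size (A 0) by omega
  induction n with
  | zero => simp
  | succ n ih =>
    have h1 := ih (fun i => bad i.castSucc) (fun i => exc i.castSucc)
      (fun i hb he => by simpa using h i.castSucc hb he)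
    have h2 := h (Fin.last n)
    simp only [Fin.val_last] at h2
    have h3 : Nat.size (A (n + 1)) ≤ Nat.size (A n) := Nat.size_le_size (hA n)
    have h4 : 0 < A n ∧ 2 * A (n + 1) ≤ A n → Nat.size (A (n + 1)) + 1 ≤ Nat.size (A n) := by
      rintro ⟨h5, h6⟩
      have h7 : 0 < Nat.size (A n) := Nat.size_pos.2 h5
      have h8 := Nat.lt_size_self (A n)
      have h9 : Nat.size (A (n + 1)) ≤ Nat.size (A n) - 1 := by
        rw [Nat.size_le]
        have : 2 ^ Nat.size (A n) = 2 * 2 ^ (Nat.size (A n) - 1) := by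
          rw [← pow_succ']; congr 1; omega
        omega
      omega
    simp only [Finset.card_filter, Fin.sum_univ_castSucc] at h1 ⊢
    by_cases hb : bad (Fin.last n) <;> by_cases he : exc (Fin.last n) <;>
      simp only [hb, he, if_true, if_false] <;>
      first | omega | (have := h4 (h2 hb he); omega)

theorem numTrue_add_le {ι : Type} {l : List ((ι → Bool) → Bool)} {x y : ι → Bool}
    {p q : ((ι → Bool) → Bool) → ℕ}
    (h : ∀ g ∈ l, (g x).toNat + p g ≤ (g y).toNat + q g) :
    numTrue l x + (l.map p).sum ≤ numTrue l y + (l.map q).sum := by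
  unfold numTrue
  rw [← List.sum_map_add, ← List.sum_map_add]
  exact List.sum_le_sum h

/-- Does `g` take different values at `x` and `y`, as a number, for a monotone `g` and `x ≤ y`? -/
def sensitivity {ι : Type} (x y : ι → Bool) (g : (ι → Bool) → Bool) : ℕ :=
  (!(g x) && g y).toNat

theorem sum_sensitivity_le_length {ι : Type} (x y : ι → Bool) (l : List ((ι → Bool) → Bool)) :
    (l.map (sensitivity x y)).sum ≤ l.length := by
  have := List.sum_le_card_nsmul (l.map (sensitivity x y)) 1 (by
    simp only [List.mem_map, forall_exists_index, and_imp, forall_apply_eq_imp_iff₂]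
    exact fun g _ => Bool.toNat_le _)
  simpa using this

theorem sensitivity_anti {ι : Type} {x x' y y' : ι → Bool} (hx : x ≤ x') (hy : y' ≤ y)
    {g : (ι → Bool) → Bool} (hg : Monotone g) : sensitivity x' y' g ≤ sensitivity x y g := by
  have h1 := hg hx
  have h2 := hg hy
  unfold sensitivity
  revert h1 h2
  cases g x <;> cases g x' <;> cases g y <;> cases g y' <;> simp

/-- Functions of depth zero are variables or constants. `Y` satisfies more of them than `Z` only if
column `i` contains more list entries than all later columns together, which halves the number of
entries not yet passed. -/
theorem hasFoolingPair_zero (s n : ℕ) (hn : 0 < n) :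
    HasFoolingPair s 0 2 n (Nat.size s / n) := by
  -- Column sums are `1, …, 1, 2, 0, …, 0` for `Y` and `1, …, 1, 0, 2, …, 2` for `Z`.
  let Y : Fin n → Fin n × Bool → Bool := fun i v =>
    if v.1 < i then v.2 else if v.1 = i then true else false
  let Z : Fin n → Fin n × Bool → Bool := fun i v =>
    if v.1 < i then v.2 else if v.1 = i then false else true
  have hsum : ∀ x : Fin n × Bool → Bool, weightedSum (fun v => n - 1 - v.1.val) x =
      ∑ b : Fin n, 2 ^ (1 * (n - 1 - b)) * ((x (b, true)).toNat + (x (b, false)).toNat) := by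
    intro x
    unfold weightedSum
    rw [Fintype.sum_prod_type]
    refine Finset.sum_congr rfl fun b _ => ?_
    rw [Fintype.sum_bool, one_mul]
    ring
  refine ⟨Fin n × Bool, Fin n, inferInstance, inferInstance, ⟨⟨0, hn⟩⟩, fun v => v.2.toNat,
    fun v => n - 1 - v.1.val, Y, Z, fun v => ?_, fun v => ?_, ?_, fun i => ?_, fun i => ?_, ?_⟩
  · exact Nat.lt_succ_of_le (Bool.toNat_le v.2)
  · have := v.1.isLt
    show n - 1 - v.1.val < n
    omega
  · rintro ⟨a, b⟩ ⟨a', b'⟩ h1 h2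
    simp only at h1 h2
    refine Prod.ext (Fin.ext ?_) ?_
    · simp only
      omega
    · revert h1
      cases b <;> cases b' <;> simp
  · rw [hsum]
    have := sum_fin_horner_eq (v := fun b => if b < i then 1 else if b = i then 2 else 0) (C := 1)
      i.isLt (fun b hb => by simp [hb]) (by simp)
      (fun b hb => by simp [hb.not_gt, hb.ne'])
    rw [one_mul] at this
    rw [← this]
    refine Finset.sum_congr rfl fun b _ => ?_
    congr 1
    simp only [Y, Fin.lt_def, Fin.ext_iff]
    split_ifs <;> rfl
  · rw [hsum]
    have := sum_fin_horner_add_le (v := fun b => if b < i then 1 else if b = i then 0 else 2)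
      (C := 1) (K := 2) i.isLt (fun b hb => by simp [hb]) (by simp)
      (fun b hb => by simp [hb.not_gt, hb.ne'])
    rw [one_mul] at this
    refine lt_of_lt_of_le (Nat.lt_add_of_pos_right two_pos) (le_trans (le_of_eq ?_) this)
    congr 1
    refine Finset.sum_congr rfl fun b _ => ?_
    congr 1
    simp only [Z, Fin.lt_def, Fin.ext_iff]
    split_ifs <;> rfl
  · intro l hl hmem
    let pre : ℕ → Bool → Fin n × Bool → Bool := fun i c v => if v.1 < i then v.2 else c
    let A : ℕ → ℕ := fun i => (l.map (sensitivity (pre i false) (pre i true))).sum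
    have hpre0 : ∀ i, pre i false ≤ pre (i + 1) false := by
      intro i v
      by_cases h1 : v.1 < i
      · simp [pre, h1, h1.trans (Nat.lt_succ_self i)]
      · simp [pre, h1]
    have hpre1 : ∀ i, pre (i + 1) true ≤ pre i true := by
      intro i v
      by_cases h1 : v.1 < i
      · simp [pre, h1, h1.trans (Nat.lt_succ_self i)]
      · simp [pre, h1, Bool.le_true]
    have hA : ∀ i, A (i + 1) ≤ A i := fun i => List.sum_le_sum fun g hg =>
      sensitivity_anti (hpre0 i) (hpre1 i) (ThresholdClass.monotone (hmem g hg))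
    -- `A i - A (i + 1)` counts the entries in column `i`, gained by `Y`; `A (i + 1)` counts those
    -- in later columns, gained by `Z`.
    have key : ∀ i : Fin n, numTrue l (Y i) + 2 * A (i + 1) ≤ numTrue l (Z i) + A i := by
      intro i
      have := numTrue_add_le (l := l) (x := Y i) (y := Z i)
        (p := fun g => sensitivity (pre (i + 1) false) (pre (i + 1) true) g +
          sensitivity (pre (i + 1) false) (pre (i + 1) true) g)
        (q := sensitivity (pre i false) (pre i true)) (by
          intro g hg
          obtain ⟨a, rfl⟩ := hmem g hg
          cases a with
          | const b => simp [sensitivity, MonotoneInput.value]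
          | var v =>
            simp only [sensitivity, MonotoneInput.value, Y, Z, pre, Fin.lt_def, Fin.ext_iff]
            rcases lt_trichotomy v.1.val i.val with h | h | h
            · simp [h, h.trans (Nat.lt_succ_self _)]
            · simp [h]
            · simp [h.not_gt, h.ne', show ¬ v.1.val < i.val + 1 by omega])
      rw [List.sum_map_add] at this
      simp only [A]
      omega
    have hle := card_filter_le_of_halving A (fun i : Fin n => numTrue l (Z i) < numTrue l (Y i))
      (fun _ => False) hA (fun i hb _ => by have := key i; omega)
    have h0 : A 0 ≤ s := (sum_sensitivity_le_length _ _ l).trans hl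
    have h1 := Nat.size_le_size h0
    simp only [Finset.filter_false, Finset.card_empty, zero_add] at hle
    rw [Fintype.card_fin, div_mul_cancel₀ _ (by positivity)]
    exact_mod_cast hle.trans h1

/-! ### The induction step: random prefixes of blocks. -/

/-- Resampling one coordinate: if an event has probability at most `c` over coordinate `i` for all
values of the other coordinates, then it has probability at most `c`. -/
theorem card_filter_le_of_update {n : ℕ} {Q : Type} [Fintype Q] [Nonempty Q] (i : Fin n)
    (P : (Fin n → Q) → Prop) [DecidablePred P] (c : ℝ)
    (h : ∀ ω, ((Finset.univ.filter fun q => P (Function.update ω i q)).card : ℝ) ≤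
      c * Fintype.card Q) :
    ((Finset.univ.filter P).card : ℝ) ≤ c * Fintype.card (Fin n → Q) := by
  -- Exchanging coordinate `i` with an independent fresh sample preserves the uniform measure.
  have hinv : Function.Involutive fun p : (Fin n → Q) × Q => (Function.update p.1 i p.2, p.1 i) := by
    rintro ⟨ω, q⟩
    simp
  have h1 : ∑ p : (Fin n → Q) × Q, (if P (Function.update p.1 i p.2) then (1 : ℝ) else 0) =
      ∑ p : (Fin n → Q) × Q, if P p.1 then (1 : ℝ) else 0 :=
    Fintype.sum_equiv hinv.toPerm _ _ fun p => rfl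
  have h3 : ∑ ω : Fin n → Q, ∑ _q : Q, (if P ω then (1 : ℝ) else 0) =
      Fintype.card Q * (Finset.univ.filter P).card := by
    simp only [Finset.sum_const, Finset.card_univ, nsmul_eq_mul]
    rw [← Finset.mul_sum, Finset.sum_boole]
  rw [Fintype.sum_prod_type, Fintype.sum_prod_type, h3] at h1
  simp only [Finset.sum_boole] at h1
  have h2 : ∑ ω : Fin n → Q, ((Finset.univ.filter fun q => P (Function.update ω i q)).card : ℝ) ≤
      ∑ _ω : Fin n → Q, c * Fintype.card Q := Finset.sum_le_sum fun ω _ => h ω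
  rw [h1, Finset.sum_const, nsmul_eq_mul, Finset.card_univ] at h2
  have hQ : (0 : ℝ) < Fintype.card Q := by exact_mod_cast Fintype.card_pos
  refine le_of_mul_le_mul_left ?_ hQ
  linarith

theorem sum_list_sum_le {α Q : Type} [Fintype Q] (l : List α) (f : Q → α → ℕ) (a : α → ℕ) (c : ℝ)
    (h : ∀ g ∈ l, (∑ q, (f q g : ℝ)) ≤ c * a g) :
    (∑ q, (((l.map (f q)).sum : ℕ) : ℝ)) ≤ c * ((l.map a).sum : ℕ) := by
  induction l with
  | nil => simp
  | cons g l ih =>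
    have h1 := h g (by simp)
    have h2 := ih fun g' hg' => h g' (by simp [hg'])
    simp only [List.map_cons, List.sum_cons, Nat.cast_add, Finset.sum_add_distrib, mul_add]
    exact add_le_add h1 h2

/-- The input whose first `i` blocks are given by `z` and the samples `ω`, whose block `i` is `mid`,
and whose other blocks are constant. -/
def blockInput {n : ℕ} {U Q : Type} (z : Q → U → Bool) (ω : Fin n → Q) (i : ℕ) (mid : U → Bool)
    (c : Bool) : Fin n × U → Bool :=
  fun v => if v.1 < i then z (ω v.1) v.2 else if v.1 = i then mid v.2 else c

section blockInput

variable {n : ℕ} {U Q : Type} (z : Q → U → Bool) (ω : Fin n → Q)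

theorem blockInput_mono (i : ℕ) {mid mid' : U → Bool} (h : mid ≤ mid') {c c' : Bool} (hc : c ≤ c') :
    blockInput z ω i mid c ≤ blockInput z ω i mid' c' := by
  intro v
  unfold blockInput
  split_ifs
  · exact le_rfl
  · exact h v.2
  · exact hc

theorem blockInput_succ (i : Fin n) (c : Bool) :
    blockInput z ω (i + 1) (fun _ => c) c = blockInput z ω i (z (ω i)) c := by
  funext v
  unfold blockInput
  rcases lt_trichotomy v.1.val i.val with h | h | h
  · simp [h, h.trans (Nat.lt_succ_self _)]
  · have : v.1 = i := Fin.ext h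
    simp [this]
  · simp [h.not_gt, h.ne', show ¬ v.1.val < i.val + 1 by omega]

theorem blockInput_update (i : Fin n) (q : Q) (mid : U → Bool) (c : Bool) :
    blockInput z (Function.update ω i q) i mid c = blockInput z ω i mid c := by
  funext v
  unfold blockInput
  by_cases h : v.1.val < i.val
  · have : v.1 ≠ i := fun h' => by simp [h'] at h
    simp [h, Function.update_of_ne this]
  · simp [h]

theorem blockInput_false_le (i : ℕ) :
    blockInput z ω i (fun _ => false) false ≤ blockInput z ω (i + 1) (fun _ => false) false := by
  intro v
  unfold blockInput
  by_cases h : v.1.val < i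
  · simp [h, h.trans (Nat.lt_succ_self _)]
  · simp [h]

theorem blockInput_true_le (i : ℕ) :
    blockInput z ω (i + 1) (fun _ => true) true ≤ blockInput z ω i (fun _ => true) true := by
  intro v
  unfold blockInput
  by_cases h : v.1.val < i
  · simp [h, h.trans (Nat.lt_succ_self _)]
  · simp [h, Bool.le_true]

/-- The restriction of the functions of a list to block `i`. -/
def restrictBlock (i : ℕ) (c : Bool) (l : List ((Fin n × U → Bool) → Bool)) :
    List ((U → Bool) → Bool) :=
  l.map fun g u => g (blockInput z ω i u c)

theorem numTrue_restrictBlock (i : ℕ) (c : Bool) (l : List ((Fin n × U → Bool) → Bool))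
    (u : U → Bool) :
    numTrue (restrictBlock z ω i c l) u = numTrue l (blockInput z ω i u c) := by
  simp [numTrue, restrictBlock, Function.comp_def]

theorem restrictBlock_mem {s e : ℕ} (i : ℕ) (c : Bool) {l : List ((Fin n × U → Bool) → Bool)}
    (hl : ∀ g ∈ l, g ∈ ThresholdClass (Fin n × U) s e) :
    ∀ g ∈ restrictBlock z ω i c l, g ∈ ThresholdClass U s e := by
  simp only [restrictBlock, List.mem_map, forall_exists_index, and_imp, forall_apply_eq_imp_iff₂]
  intro g hg
  convert ThresholdClass.subst (hl g hg) (fun v : Fin n × U => if v.1 < i then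
    MonotoneInput.const (z (ω v.1) v.2) else if v.1 = i then .var v.2 else .const c) using 3 with u
  funext v
  unfold blockInput
  split_ifs <;> rfl

/-- A function that is `1` more often than tolerated in the step from block `i` to block `i + 1`. -/
def blockFailure (y m : Q → U → Bool) (i : Fin n) (g : (Fin n × U → Bool) → Bool) : ℕ :=
  if (g (blockInput z ω i (m (ω i)) true)).toNat < (g (blockInput z ω i (y (ω i)) false)).toNat +
    sensitivity (blockInput z ω (i + 1) (fun _ => false) false)
      (blockInput z ω (i + 1) (fun _ => true) true) g then 1 else 0

/-- By monotonicity, a function that takes the same value on the all-zero and all-one continuations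
of the prefix is constant on all continuations. -/
theorem blockFailure_eq_zero (y m : Q → U → Bool) (i : Fin n) {g : (Fin n × U → Bool) → Bool}
    (hg : Monotone g)
    (h : sensitivity (blockInput z ω i (fun _ => false) false)
      (blockInput z ω i (fun _ => true) true) g = 0) : blockFailure z ω y m i g = 0 := by
  have h1 := hg (blockInput_mono z ω i (mid := fun _ => false) (mid' := y (ω i))
    (fun _ => Bool.false_le _) (le_refl false))
  have h2 := hg (blockInput_mono z ω i (mid := fun _ => false) (mid' := m (ω i))
    (fun _ => Bool.false_le _) (Bool.false_le true))
  have h3 := hg (blockInput_mono z ω i (mid := y (ω i)) (mid' := fun _ => true)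
    (fun _ => Bool.le_true _) (Bool.false_le true))
  have h4 := hg (blockInput_mono z ω i (mid := m (ω i)) (mid' := fun _ => true)
    (fun _ => Bool.le_true _) (le_refl true))
  have h5 := sensitivity_anti (blockInput_false_le z ω i) (blockInput_true_le z ω i) hg
  rw [h, Nat.le_zero] at h5
  rw [blockFailure, h5]
  unfold sensitivity at h
  revert h h1 h2 h3 h4
  cases g (blockInput z ω i (fun _ => false) false) <;>
  cases g (blockInput z ω i (fun _ => true) true) <;>
  cases g (blockInput z ω i (y (ω i)) false) <;>
  cases g (blockInput z ω i (m (ω i)) true) <;> simp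

/-- The sample `z` interpolates between `y` and `m`. If the top gate of `g` loses no true input from
`y` to `z` (zeros behind) nor from `z` to `m` (ones behind), then `g` at `m` is at least `g` at `z`
with ones behind, which is `g` at `z` with zeros behind plus the sensitivity. Each of the two losses
has probability at most `ε`. -/
theorem sum_blockFailure_le [Fintype Q] {s e : ℕ} {ε : ℝ} {y m : Q → U → Bool}
    (hyz : Fools s e ε y z) (hzm : Fools s e ε z m) (i : Fin n) {g : (Fin n × U → Bool) → Bool}
    (hg : g ∈ ThresholdClass (Fin n × U) s (e + 1)) :
    (∑ q, (blockFailure z (Function.update ω i q) y m i g : ℝ)) ≤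
      2 * ε * Fintype.card Q * sensitivity (blockInput z ω i (fun _ => false) false)
        (blockInput z ω i (fun _ => true) true) g := by
  have hmono := ThresholdClass.monotone hg
  rcases Nat.eq_zero_or_pos (sensitivity (blockInput z ω i (fun _ => false) false)
        (blockInput z ω i (fun _ => true) true) g) with h0 | h0
  · rw [h0, Finset.sum_eq_zero]
    · simp
    · intro q _
      rw [blockFailure_eq_zero _ _ _ _ _ hmono (by simpa only [blockInput_update] using h0)]
      simp
  have h1 : sensitivity (blockInput z ω i (fun _ => false) false)
        (blockInput z ω i (fun _ => true) true) g = 1 :=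
    le_antisymm (Bool.toNat_le _) h0
  obtain ⟨t, l, hl, hmem, rfl⟩ := hg
  have hA := hyz (restrictBlock z ω i false l) (by simpa [restrictBlock] using hl)
    (restrictBlock_mem z ω i false hmem)
  have hB := hzm (restrictBlock z ω i true l) (by simpa [restrictBlock] using hl)
    (restrictBlock_mem z ω i true hmem)
  rw [h1]
  have hpt : ∀ q, (blockFailure z (Function.update ω i q) y m i (fun x => thr t (l.map fun g => g x)) : ℝ)
      ≤ (if numTrue (restrictBlock z ω i false l) (z q) < numTrue (restrictBlock z ω i false l) (y q)
          then (1 : ℝ) else 0) +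
        (if numTrue (restrictBlock z ω i true l) (m q) < numTrue (restrictBlock z ω i true l) (z q)
          then (1 : ℝ) else 0) := by
    intro q
    have hlow := numTrue_mono (fun g hg => ThresholdClass.monotone (hmem g hg))
      (blockInput_mono z ω i (mid := z q) (mid' := z q) le_rfl (Bool.false_le true))
    simp only [blockFailure, blockInput_succ, blockInput_update, Function.update_self,
      numTrue_restrictBlock, thr_map_eq, sensitivity]
    generalize numTrue l (blockInput z ω i (y q) false) = a at *
    generalize numTrue l (blockInput z ω i (z q) false) = b at *
    generalize numTrue l (blockInput z ω i (z q) true) = c at *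
    generalize numTrue l (blockInput z ω i (m q) true) = d at *
    by_cases hab : b < a
    · rw [if_pos hab]
      split_ifs <;> norm_num
    by_cases hcd : d < c
    · rw [if_pos hcd]
      split_ifs <;> norm_num
    rw [if_neg]
    · simp [hab, hcd]
    · by_cases h1 : t ≤ a <;> by_cases h2 : t ≤ b <;> by_cases h3 : t ≤ c <;> by_cases h4 : t ≤ d <;>
        first | omega | simp [h1, h2, h3, h4]
  refine (Finset.sum_le_sum fun q _ => hpt q).trans ?_
  rw [Finset.sum_add_distrib, Finset.sum_boole, Finset.sum_boole]
  push_cast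
  linarith

end blockInput

/-- Given the samples outside block `i`, the expected number of failures is at most `2 * ε` times
the number of undetermined functions. By Markov's inequality, more than a quarter of them fail with
probability at most `8 * ε`. Without such an exception, a win of `Y` halves the number of
undetermined functions. -/
theorem fools_blockInput {n : ℕ} (hn : 0 < n) {U Q : Type} [Fintype Q] [Nonempty Q] {s e : ℕ}
    {ε : ℝ} {y z m : Q → U → Bool} (hyz : Fools s e ε y z) (hzm : Fools s e ε z m) :
    Fools s (e + 1) (8 * ε + Nat.size s / n)
      (fun o : Fin n × (Fin n → Q) => blockInput z o.2 o.1 (y (o.2 o.1)) false)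
      (fun o : Fin n × (Fin n → Q) => blockInput z o.2 o.1 (m (o.2 o.1)) true) := by
  classical
  intro l hl hmem
  have hmono : ∀ g ∈ l, Monotone g := fun g hg => ThresholdClass.monotone (hmem g hg)
  let A : (Fin n → Q) → ℕ → ℕ := fun ω i => (l.map (sensitivity
    (blockInput z ω i (fun _ => false) false) (blockInput z ω i (fun _ => true) true))).sum
  let F : (Fin n → Q) → Fin n → ℕ := fun ω i => (l.map (blockFailure z ω y m i)).sum
  let bad : (Fin n → Q) → Fin n → Prop := fun ω i =>
    numTrue l (blockInput z ω i (m (ω i)) true) < numTrue l (blockInput z ω i (y (ω i)) false)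
  let exc : (Fin n → Q) → Fin n → Prop := fun ω i => A ω i < 4 * F ω i
  have hFA : ∀ ω (i : Fin n), A ω i = 0 → F ω i = 0 := by
    intro ω i h
    simp only [A, F, List.sum_eq_zero_iff, List.mem_map, forall_exists_index, and_imp,
      forall_apply_eq_imp_iff₂] at h ⊢
    exact fun g hg => blockFailure_eq_zero z ω y m i (hmono g hg) (h g hg)
  have hcount : ∀ ω, (Finset.univ.filter (bad ω)).card ≤
      (Finset.univ.filter (exc ω)).card + Nat.size s := by
    intro ω
    refine (card_filter_le_of_halving (A ω) (bad ω) (exc ω) (fun i => ?_) (fun i hb he => ?_)).trans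
      (Nat.add_le_add_left (Nat.size_le_size ((sum_sensitivity_le_length _ _ l).trans hl)) _)
    · exact List.sum_le_sum fun g hg =>
        sensitivity_anti (blockInput_false_le z ω i) (blockInput_true_le z ω i) (hmono g hg)
    -- A failing function can spoil the inequality by two, once through its value at `y` and once
    -- through its sensitivity, so failures count double.
    · have h1 := numTrue_add_le (l := l) (x := blockInput z ω i (y (ω i)) false)
        (y := blockInput z ω i (m (ω i)) true)
        (p := sensitivity (blockInput z ω (i + 1) (fun _ => false) false)
          (blockInput z ω (i + 1) (fun _ => true) true))
        (q := fun g => blockFailure z ω y m i g + blockFailure z ω y m i g) (by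
          intro g _
          unfold blockFailure
          split_ifs with h
          · have h1 := Bool.toNat_le (g (blockInput z ω i (y (ω i)) false))
            have h2 : sensitivity (blockInput z ω (i + 1) (fun _ => false) false)
              (blockInput z ω (i + 1) (fun _ => true) true) g ≤ 1 := Bool.toNat_le _
            omega
          · omega)
      rw [List.sum_map_add] at h1
      have h2 : ¬ A ω i < 4 * F ω i := he
      have h3 : numTrue l (blockInput z ω i (m (ω i)) true) <
        numTrue l (blockInput z ω i (y (ω i)) false) := hb
      have h4 := hFA ω i
      simp only [A, F] at h2 h4 ⊢
      omega
  have hexc : ∀ i, ((Finset.univ.filter fun ω => exc ω i).card : ℝ) ≤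
      8 * ε * Fintype.card (Fin n → Q) := by
    intro i
    refine card_filter_le_of_update i _ _ fun ω => ?_
    have hAu : ∀ q, A (Function.update ω i q) i = A ω i := by
      intro q
      simp only [A, blockInput_update]
    have hsum : (∑ q, (F (Function.update ω i q) i : ℝ)) ≤ 2 * ε * Fintype.card Q * A ω i :=
      sum_list_sum_le l _ _ _ fun g hg => sum_blockFailure_le z ω hyz hzm i (hmem g hg)
    -- Nonnegativity comes from the fooling bound for the empty list.
    have hε : 0 ≤ ε * Fintype.card Q := by
      refine le_trans ?_ (hyz [] (by simp) (by simp))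
      positivity
    rcases Nat.eq_zero_or_pos (A ω i) with h0 | h0
    · rw [Finset.filter_false_of_mem]
      · simp only [Finset.card_empty, Nat.cast_zero]
        linarith
      · intro q _ hq
        have h1 : A (Function.update ω i q) i < 4 * F (Function.update ω i q) i := hq
        have h2 := hFA _ _ ((hAu q).trans h0)
        omega
    · have h0' : (0 : ℝ) < A ω i := by exact_mod_cast h0
      refine le_of_mul_le_mul_right ?_ h0'
      rw [Finset.card_filter, Nat.cast_sum, Finset.sum_mul]
      calc ∑ q, ((if exc (Function.update ω i q) i then 1 else 0 : ℕ) : ℝ) * A ω i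
          ≤ ∑ q, 4 * (F (Function.update ω i q) i : ℝ) := by
            refine Finset.sum_le_sum fun q _ => ?_
            by_cases h : exc (Function.update ω i q) i
            · have h1 : A (Function.update ω i q) i < 4 * F (Function.update ω i q) i := h
              rw [hAu] at h1
              rw [if_pos h, Nat.cast_one, one_mul]
              exact_mod_cast h1.le
            · rw [if_neg h]
              simp
        _ ≤ 8 * ε * Fintype.card Q * A ω i := by
            rw [← Finset.mul_sum]
            linarith
  have htotal : ((Finset.univ.filter fun o : Fin n × (Fin n → Q) => bad o.2 o.1).card : ℝ) ≤
      (8 * ε + Nat.size s / n) * Fintype.card (Fin n × (Fin n → Q)) := by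
    have h1 : (Finset.univ.filter fun o : Fin n × (Fin n → Q) => bad o.2 o.1).card =
        ∑ ω : Fin n → Q, (Finset.univ.filter (bad ω)).card := by
      simp only [Finset.card_filter]
      rw [Fintype.sum_prod_type_right]
    have h2 : ∑ ω : Fin n → Q, (Finset.univ.filter (exc ω)).card =
        ∑ i : Fin n, (Finset.univ.filter fun ω => exc ω i).card := by
      simp only [Finset.card_filter]
      rw [Finset.sum_comm]
    have h3 : (∑ ω : Fin n → Q, (Finset.univ.filter (bad ω)).card) ≤
        (∑ i : Fin n, (Finset.univ.filter fun ω => exc ω i).card) +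
          Fintype.card (Fin n → Q) * Nat.size s := by
      rw [← h2]
      refine (Finset.sum_le_sum fun ω _ => hcount ω).trans (le_of_eq ?_)
      rw [Finset.sum_add_distrib, Finset.sum_const, Finset.card_univ, smul_eq_mul]
    have h4 : (∑ i : Fin n, ((Finset.univ.filter fun ω => exc ω i).card : ℝ)) ≤
        n * (8 * ε * Fintype.card (Fin n → Q)) := by
      refine (Finset.sum_le_sum fun i _ => hexc i).trans (le_of_eq ?_)
      simp
    have h5 : ((∑ ω : Fin n → Q, (Finset.univ.filter (bad ω)).card : ℕ) : ℝ) ≤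
        n * (8 * ε * Fintype.card (Fin n → Q)) + Fintype.card (Fin n → Q) * Nat.size s := by
      refine (Nat.cast_le.2 h3).trans ?_
      push_cast at h4 ⊢
      linarith
    rw [h1]
    refine h5.trans (le_of_eq ?_)
    have hn' : (n : ℝ) ≠ 0 := by positivity
    rw [Fintype.card_prod, Fintype.card_fin, Nat.cast_mul]
    field_simp
  exact htotal

/-! ### Building the next fooling pair from blocks. -/

theorem weightedSum_block {n C : ℕ} {U : Type} [Fintype U] (ex : U → ℕ) (x : Fin n × U → Bool) :
    weightedSum (fun v : Fin n × U => C * (n - 1 - v.1) + ex v.2) x =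
      ∑ b : Fin n, 2 ^ (C * (n - 1 - b)) * weightedSum ex fun u => x (b, u) := by
  unfold weightedSum
  rw [Fintype.sum_prod_type]
  refine Finset.sum_congr rfl fun b _ => ?_
  rw [Finset.mul_sum]
  refine Finset.sum_congr rfl fun u _ => ?_
  rw [pow_add, mul_assoc]

theorem weightedSum_const_false {V : Type} [Fintype V] (ex : V → ℕ) :
    weightedSum ex (fun _ => false) = 0 := by
  simp [weightedSum]

/-- An all-one block can exceed its normal range, but its sum is at most `k * 2 ^ C - k`; a
shortfall of `k` in block `i` therefore survives all later blocks. -/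
theorem hasFoolingPair_of_block {s e k C n : ℕ} {ε : ℝ} (hn : 0 < n) (hk : 0 < k) {U Q : Type}
    [Fintype U] [Fintype Q] [Nonempty Q] (row ex : U → ℕ) {y z m : Q → U → Bool}
    (hrow : ∀ u, row u < k) (hex : ∀ u, ex u < C)
    (hinj : ∀ u v, row u = row v → ex u = ex v → u = v)
    (hy : ∀ q, weightedSum ex (y q) = 2 ^ C) (hz : ∀ q, weightedSum ex (z q) + 1 = 2 ^ C)
    (hm : ∀ q, weightedSum ex (m q) + k ≤ 2 ^ C)
    (hone : weightedSum ex (fun _ => true) + k ≤ k * 2 ^ C)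
    (hyz : Fools s e ε y z) (hzm : Fools s e ε z m) :
    HasFoolingPair s (e + 1) k (C * n) (8 * ε + Nat.size s / n) := by
  have : NeZero n := ⟨hn.ne'⟩
  refine ⟨Fin n × U, Fin n × (Fin n → Q), inferInstance, inferInstance, inferInstance,
    fun v => row v.2, fun v => C * (n - 1 - v.1) + ex v.2, _, _, fun v => hrow v.2, fun v => ?_, ?_,
    fun o => ?_, fun o => ?_, fools_blockInput hn hyz hzm⟩
  · have h1 := hex v.2
    have h2 := v.1.isLt
    calc C * (n - 1 - v.1) + ex v.2 < C * (n - 1 - v.1) + C := by omega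
      _ = C * ((n - 1 - v.1) + 1) := by ring
      _ ≤ C * n := Nat.mul_le_mul_left _ (by omega)
  · rintro ⟨a, u⟩ ⟨b, v⟩ h1 h2
    simp only at h1 h2
    have hu := hex u
    have hv := hex v
    have hC : 0 < C := by omega
    have h3 := congrArg (· / C) h2
    have h4 := congrArg (· % C) h2
    simp only [Nat.mul_add_div hC, Nat.div_eq_of_lt hu, Nat.div_eq_of_lt hv, Nat.mul_add_mod,
      Nat.mod_eq_of_lt hu, Nat.mod_eq_of_lt hv] at h3 h4
    refine Prod.ext (Fin.ext ?_) (hinj u v h1 h4)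
    have := a.isLt
    have := b.isLt
    simp only
    omega
  · rw [weightedSum_block, ← sum_fin_horner_eq (v := fun b => if b < o.1.val then 2 ^ C - 1 else
      if b = o.1.val then 2 ^ C else 0) o.1.isLt
      (fun b hb => by
        simp only [hb, if_true]
        exact Nat.sub_add_cancel Nat.one_le_two_pow)
      (by simp) (fun b hb => by simp [hb.not_gt, hb.ne'])]
    refine Finset.sum_congr rfl fun b _ => ?_
    congr 1
    simp only [blockInput]
    split_ifs with h1 h2
    · have : weightedSum ex (fun u => z (o.2 b) u) + 1 = 2 ^ C := hz (o.2 b)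
      omega
    · exact hy _
    · exact weightedSum_const_false ex
  · have h := sum_fin_horner_add_le (v := fun b => if b < o.1.val then 2 ^ C - 1 else
      if b = o.1.val then weightedSum ex (m (o.2 o.1)) else weightedSum ex fun _ => true) (C := C)
      (K := k) o.1.isLt
      (fun b hb => by
        simp only [hb, if_true]
        exact Nat.sub_add_cancel Nat.one_le_two_pow)
      (by simpa using hm (o.2 o.1)) (fun b hb => by simpa [hb.not_gt, hb.ne'] using hone)
    refine lt_of_lt_of_le (Nat.lt_add_of_pos_right hk) (le_trans (le_of_eq ?_) h)
    rw [weightedSum_block]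
    congr 1
    refine Finset.sum_congr rfl fun b _ => ?_
    congr 1
    simp only [blockInput]
    split_ifs with h1 h2
    · have : weightedSum ex (fun u => z (o.2 b) u) + 1 = 2 ^ C := hz (o.2 b)
      omega
    · rfl
    · rfl

theorem weightedSum_elim {V W : Type} [Fintype V] [Fintype W] (a : V → ℕ) (b : W → ℕ)
    (x : V → Bool) (y : W → Bool) :
    weightedSum (Sum.elim a b) (Sum.elim x y) = weightedSum a x + weightedSum b y := by
  simp [weightedSum]

theorem weightedSum_shift {V : Type} [Fintype V] (r : ℕ) (ex : V → ℕ) (x : V → Bool) :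
    weightedSum (fun v => r + ex v) x = 2 ^ r * weightedSum ex x := by
  simp [weightedSum, Finset.mul_sum, pow_add, mul_assoc]

theorem weightedSum_testBit {C m : ℕ} (h : m < 2 ^ C) :
    weightedSum (fun c : Fin C => (c : ℕ)) (fun c => m.testBit c) = m := by
  have key : ∀ C, ∑ c : Fin C, 2 ^ (c : ℕ) * (m.testBit c).toNat = m % 2 ^ C := by
    intro C
    induction C with
    | zero => simp [Nat.mod_one]
    | succ C ih =>
      rw [Fin.sum_univ_castSucc, Nat.mod_pow_succ, ← Nat.toNat_testBit]
      simp [ih]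
  rw [weightedSum, key, Nat.mod_eq_of_lt h]

/-- Distinct variables occupy distinct cells, and a full row has sum `2 ^ N - 1`. -/
theorem weightedSum_add_le {V : Type} [Fintype V] {k N : ℕ} {row ex : V → ℕ}
    (hrow : ∀ v, row v < k) (hex : ∀ v, ex v < N)
    (hinj : ∀ u v, row u = row v → ex u = ex v → u = v) (x : V → Bool) :
    weightedSum ex x + k ≤ k * 2 ^ N := by
  let f : V → Fin k × Fin N := fun v => (⟨row v, hrow v⟩, ⟨ex v, hex v⟩)
  have hf : Function.Injective f := by
    intro u v huv
    simp only [f, Prod.mk.injEq, Fin.mk.injEq] at huv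
    exact hinj u v huv.1 huv.2
  have h1 : weightedSum ex x ≤ ∑ v, 2 ^ (f v).2.val := by
    refine Finset.sum_le_sum fun v _ => ?_
    exact (Nat.mul_le_mul_left _ (Bool.toNat_le (x v))).trans (mul_one _).le
  have h2 : ∑ v, 2 ^ (f v).2.val ≤ ∑ p : Fin k × Fin N, 2 ^ p.2.val := by
    rw [← Finset.sum_image (f := fun p : Fin k × Fin N => 2 ^ p.2.val) (g := f) (s := Finset.univ)
      fun a _ b _ h => hf h]
    exact Finset.sum_le_sum_of_subset (Finset.subset_univ _)
  have h3 : ∑ p : Fin k × Fin N, 2 ^ p.2.val = k * (2 ^ N - 1) := by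
    rw [Fintype.sum_prod_type]
    simp only [Finset.sum_const, Finset.card_univ, Fintype.card_fin, smul_eq_mul]
    rw [Fin.sum_univ_eq_sum_range (fun j => 2 ^ j), Nat.geomSum_eq le_rfl]
    simp
  have h4 : k * (2 ^ N - 1) + k = k * 2 ^ N := by
    rw [← Nat.mul_succ, Nat.succ_eq_add_one, Nat.sub_add_cancel Nat.one_le_two_pow]
  omega

theorem card_filter_prod_le {Q Ω : Type} [Fintype Q] [Fintype Ω] (P : Ω × Q → Prop)
    [DecidablePred P] (ε : ℝ)
    (h : ∀ q, ((Finset.univ.filter fun o => P (o, q)).card : ℝ) ≤ ε * Fintype.card Ω) :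
    ((Finset.univ.filter P).card : ℝ) ≤ ε * Fintype.card (Ω × Q) := by
  have h1 : (Finset.univ.filter P).card =
      ∑ q : Q, (Finset.univ.filter fun o : Ω => P (o, q)).card := by
    simp only [Finset.card_filter]
    rw [Fintype.sum_prod_type_right]
  rw [h1, Nat.cast_sum]
  refine (Finset.sum_le_sum fun q _ => h q).trans (le_of_eq ?_)
  rw [Finset.sum_const, Finset.card_univ, nsmul_eq_mul, Fintype.card_prod, Nat.cast_mul]
  ring

theorem Fools.subst {V W Ω : Type} [Fintype Ω] {s e : ℕ} {ε : ℝ} {Y Z : Ω → V → Bool}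
    (h : Fools s e ε Y Z) (τ : W → MonotoneInput V) {l : List ((W → Bool) → Bool)}
    (hl : l.length ≤ s) (hmem : ∀ g ∈ l, g ∈ ThresholdClass W s e) :
    ((Finset.univ.filter fun o => numTrue l (fun w => (τ w).value (Z o)) <
      numTrue l (fun w => (τ w).value (Y o))).card : ℝ) ≤ ε * Fintype.card Ω := by
  have := h (l.map fun g y => g fun w => (τ w).value y) (by simpa using hl) (by
    simp only [List.mem_map, forall_exists_index, and_imp, forall_apply_eq_imp_iff₂]
    exact fun g hg => ThresholdClass.subst (hmem g hg) τ)
  convert this using 6 <;> simp [numTrue, Function.comp_def]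

/-- A block holds two independent copies of the old pair and a filler row. Passing from `y` to `z`
replaces `Y` by `Z` in the first copy, and the filler brings the sum up to exactly `2 ^ C - 1`;
passing from `z` to `m` does the same in the second copy, without compensation. Fixing the other
copy, each passage is fooled by the old pair. -/
theorem HasFoolingPair.succ {s e k N n : ℕ} {ε : ℝ} (h : HasFoolingPair s e k N ε) (hn : 0 < n) :
    HasFoolingPair s (e + 1) (2 * k + 1) ((N + (2 * k + 1) + 1) * n) (8 * ε + Nat.size s / n) := by
  obtain ⟨V, Ω, _, _, _, row, ex, Y, Z, hrow, hex, hinj, hY, hZ, hfool⟩ := h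
  -- The copies are shifted by `r` places so that a deficit of one unit becomes `2 ^ r`, more than
  -- the number `r` of rows. The last place in `C` makes room for the sum of two copies.
  set r := 2 * k + 1 with hr
  set C := N + r + 1 with hC
  have hpow : 2 ^ C = 2 ^ r * 2 ^ N + 2 ^ r * 2 ^ N := by
    rw [hC, pow_succ, pow_add]
    ring
  have hrr : r < 2 ^ r := Nat.lt_two_pow_self
  have hZ' : ∀ o, 2 ^ r * weightedSum ex (Z o) + 2 ^ r ≤ 2 ^ r * 2 ^ N := by
    intro o
    rw [← Nat.mul_succ]
    exact Nat.mul_le_mul_left _ (hZ o)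
  let fill : Ω → Fin C → Bool := fun o c =>
    (2 ^ r * 2 ^ N - 1 - 2 ^ r * weightedSum ex (Z o)).testBit c
  have hfill : ∀ o, weightedSum (fun c : Fin C => (c : ℕ)) (fill o) =
      2 ^ r * 2 ^ N - 1 - 2 ^ r * weightedSum ex (Z o) := by
    intro o
    refine weightedSum_testBit ?_
    have := hZ' o
    omega
  let ex' : V ⊕ V ⊕ Fin C → ℕ :=
    Sum.elim (fun v => r + ex v) (Sum.elim (fun v => r + ex v) fun c => c)
  let row' : V ⊕ V ⊕ Fin C → ℕ := Sum.elim row (Sum.elim (fun v => k + row v) fun _ => 2 * k)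
  let y : Ω × Ω → V ⊕ V ⊕ Fin C → Bool := fun q =>
    Sum.elim (Y q.1) (Sum.elim (Y q.2) fun _ => false)
  let z : Ω × Ω → V ⊕ V ⊕ Fin C → Bool := fun q =>
    Sum.elim (Z q.1) (Sum.elim (Y q.2) (fill q.1))
  let m : Ω × Ω → V ⊕ V ⊕ Fin C → Bool := fun q =>
    Sum.elim (Z q.1) (Sum.elim (Z q.2) (fill q.1))
  have hrow' : ∀ u, row' u < r := by
    rintro (v | v | c)
    · have := hrow v
      simp only [row', Sum.elim_inl]
      omega
    · have := hrow v
      simp only [row', Sum.elim_inl, Sum.elim_inr]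
      omega
    · simp only [row', Sum.elim_inr]
      omega
  have hex' : ∀ u, ex' u < C := by
    rintro (v | v | c)
    · have := hex v
      simp only [ex', Sum.elim_inl]
      omega
    · have := hex v
      simp only [ex', Sum.elim_inl, Sum.elim_inr]
      omega
    · exact c.isLt
  have hinj' : ∀ u v, row' u = row' v → ex' u = ex' v → u = v := by
    rintro (u | u | c) (v | v | c') h1 h2 <;>
      simp only [row', ex', Sum.elim_inl, Sum.elim_inr] at h1 h2
    · rw [hinj u v h1 (by omega)]
    · have := hrow u
      omega
    · have := hrow u
      omega
    · have := hrow v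
      omega
    · rw [hinj u v (by omega) (by omega)]
    · have := hrow u
      omega
    · have := hrow v
      omega
    · have := hrow v
      omega
    · rw [Fin.ext h2]
  refine hasFoolingPair_of_block hn (by omega) row' ex' (y := y) (z := z) (m := m) hrow' hex' hinj'
    (fun q => ?_) (fun q => ?_) (fun q => ?_) (weightedSum_add_le hrow' hex' hinj' _) ?_ ?_
  · simp only [y, ex', weightedSum_elim, weightedSum_shift, weightedSum_const_false, hY]
    omega
  · simp only [z, ex', weightedSum_elim, weightedSum_shift, hY, hfill]
    have := hZ' q.1
    omega
  · simp only [m, ex', weightedSum_elim, weightedSum_shift, hfill]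
    have h1 := hZ' q.1
    have h2 := hZ' q.2
    omega
  · intro l hl hmem
    refine card_filter_prod_le _ _ fun q => ?_
    refine le_trans (Nat.cast_le.2 (Finset.card_le_card ?_)) (hfool.subst (Sum.elim .var
      (Sum.elim (fun v => .const (Y q v)) fun _ => .const false)) hl hmem)
    intro o
    simp only [Finset.mem_filter, Finset.mem_univ, true_and]
    have h1 : (fun w => (Sum.elim MonotoneInput.var (Sum.elim (fun v => .const (Y q v))
        fun _ => .const false) w : MonotoneInput V).value (Y o)) = y (o, q) := by
      funext w
      rcases w with (v | v | c) <;> rfl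
    -- The filler depends on the sample `o`, so it is first replaced by zeros; monotonicity allows
    -- this.
    have h2 : (fun w => (Sum.elim MonotoneInput.var (Sum.elim (fun v => .const (Y q v))
        fun _ => .const false) w : MonotoneInput V).value (Z o)) ≤ z (o, q) := by
      rintro (v | v | c)
      · exact le_rfl
      · exact le_rfl
      · exact Bool.false_le _
    rw [h1]
    exact fun h3 =>
      (numTrue_mono (fun g hg => ThresholdClass.monotone (hmem g hg)) h2).trans_lt h3
  · intro l hl hmem
    -- Now the first copy is the one held fixed, hence the swap of coordinates.
    have hswap := card_filter_prod_le (Q := Ω) (Ω := Ω)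
      (fun p => numTrue l (m p.swap) < numTrue l (z p.swap)) ε fun q => by
        refine le_trans (Nat.cast_le.2 (Finset.card_le_card ?_)) (hfool.subst
          (Sum.elim (fun v => .const (Z q v)) (Sum.elim .var fun c => .const (fill q c))) hl hmem)
        intro o
        simp only [Finset.mem_filter, Finset.mem_univ, true_and]
        intro h1
        convert h1 using 2
        · funext w
          rcases w with (v | v | c) <;> rfl
        · funext w
          rcases w with (v | v | c) <;> rfl
    refine le_trans (le_of_eq ?_) hswap
    congr 1
    exact Finset.card_equiv (Equiv.prodComm _ _) (by simp)

/-! ### Choice of parameters and the lower bound. -/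

/-- The number of rows of the fooling pair for depth `e`. -/
def foolingRows : ℕ → ℕ
  | 0 => 2
  | e + 1 => 2 * foolingRows e + 1

/-- The number of columns of the fooling pair for depth `e` with `n` blocks per level. -/
def foolingColumns (n : ℕ) : ℕ → ℕ
  | 0 => n
  | e + 1 => (foolingColumns n e + (2 * foolingRows e + 1) + 1) * n

theorem hasFoolingPair (s n e : ℕ) (hn : 0 < n) :
    ∃ ε : ℝ, ε ≤ 9 ^ e * (Nat.size s / n) ∧
      HasFoolingPair s e (foolingRows e) (foolingColumns n e) ε := by
  induction e with
  | zero => exact ⟨_, by simp, hasFoolingPair_zero s n hn⟩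
  | succ e ih =>
    obtain ⟨ε, hε, h⟩ := ih
    refine ⟨_, ?_, h.succ hn⟩
    have h1 : (0 : ℝ) ≤ Nat.size s / n := by positivity
    have h2 : (1 : ℝ) ≤ 9 ^ e := one_le_pow₀ (by norm_num)
    rw [pow_succ]
    nlinarith

theorem exists_foolingColumns_le (e : ℕ) : ∃ c : ℕ, 0 < c ∧ ∀ n, foolingColumns n e ≤ c * n ^ (e + 1) := by
  induction e with
  | zero => exact ⟨1, one_pos, fun n => by simp [foolingColumns]⟩
  | succ e ih =>
    obtain ⟨c, hc, h⟩ := ih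
    refine ⟨c + (2 * foolingRows e + 1) + 1, by omega, fun n => ?_⟩
    rcases Nat.eq_zero_or_pos n with rfl | hn
    · simp [foolingColumns]
    rw [foolingColumns, pow_succ, ← mul_assoc]
    refine Nat.mul_le_mul_right _ ?_
    have h1 := h n
    have h2 : 1 ≤ n ^ (e + 1) := Nat.one_le_pow _ _ hn
    nlinarith

theorem rowSum_eq_sum {k N : ℕ} (x : Fin k × Fin N → Bool) :
    rowSum x = ∑ p : Fin k × Fin N, 2 ^ (N - (p.2.val + 1)) * (x p).toNat := by
  unfold rowSum
  rw [Fintype.sum_prod_type_right]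
  exact Finset.sum_congr rfl fun j _ => Finset.mul_sum _ _ _

/-- The top gate would have to see strictly more true inputs at `Y` than at `Z` for every sample,
contradicting `ε < 1`. -/
theorem not_mem_thresholdClass_of_hasFoolingPair {s e k N K n : ℕ} {ε : ℝ}
    (h : HasFoolingPair s e K N ε) (hε : ε < 1) (hK : K ≤ k) (hN : N ≤ n) :
    addThreshold k n ∉ ThresholdClass (Fin k × Fin n) s (e + 1) := by
  classical
  intro hmem
  obtain ⟨V, Ω, _, _, _, row, ex, Y, Z, hrow, hex, hinj, hY, hZ, hfool⟩ := h
  -- The pair occupies the `N` most significant columns; this scales all sums by `2 ^ (n - N)`.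
  let pos : V → Fin k × Fin n := fun v =>
    (⟨row v, (hrow v).trans_le hK⟩, ⟨N - 1 - ex v, by have := hex v; omega⟩)
  have hpos : Function.Injective pos := by
    intro u v huv
    simp only [pos, Prod.mk.injEq, Fin.mk.injEq] at huv
    have := hex u
    have := hex v
    exact hinj u v huv.1 (by omega)
  let τ : Fin k × Fin n → MonotoneInput V := fun p =>
    if h : ∃ v, pos v = p then .var h.choose else .const false
  have hτ : ∀ (x : V → Bool) v, (τ (pos v)).value x = x v := by
    intro x v
    have h : ∃ u, pos u = pos v := ⟨v, rfl⟩
    simp only [τ, dif_pos h, MonotoneInput.value]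
    rw [hpos h.choose_spec]
  have hτ' : ∀ (x : V → Bool) p, p ∉ Set.range pos → (τ p).value x = false := by
    intro x p hp
    have h : ¬ ∃ u, pos u = p := hp
    simp only [τ, dif_neg h, MonotoneInput.value]
  have hsum : ∀ x : V → Bool,
      rowSum (fun p => (τ p).value x) = 2 ^ (n - N) * weightedSum ex x := by
    intro x
    rw [rowSum_eq_sum, weightedSum, Finset.mul_sum]
    symm
    refine Fintype.sum_of_injective pos hpos _ _ (fun p hp => ?_) fun v => ?_
    · rw [hτ' x p hp]
      rfl
    · rw [hτ, ← mul_assoc, ← pow_add]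
      congr 2
      have := hex v
      simp only [pos]
      omega
  have hpow : 2 ^ n = 2 ^ (n - N) * 2 ^ N := by
    rw [← pow_add, Nat.sub_add_cancel hN]
  obtain ⟨t, l, hl, hlm, hf⟩ := ThresholdClass.subst hmem τ
  have hval : ∀ x : V → Bool, 2 ^ N ≤ weightedSum ex x ↔ t ≤ numTrue l x := by
    intro x
    have h1 := congrFun hf x
    simp only [addThreshold, hsum, thr_map_eq, hpow, decide_eq_decide] at h1
    rw [← h1]
    exact (Nat.mul_le_mul_left_iff (by positivity)).symm
  have hbad := hfool l hl hlm
  have hall : ∀ o, numTrue l (Z o) < numTrue l (Y o) := by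
    intro o
    have h1 := (hval (Y o)).1 (hY o).ge
    have h2 := mt (hval (Z o)).2 (hZ o).not_ge
    omega
  rw [Finset.filter_true_of_mem fun o _ => hall o, Finset.card_univ] at hbad
  have hpos : (0 : ℝ) < Fintype.card Ω := by exact_mod_cast Fintype.card_pos
  nlinarith

theorem Nat.size_le_of_lt_two_rpow {s : ℕ} {L : ℝ} (hs : 1 ≤ s) (h : (s : ℝ) < 2 ^ L) :
    (Nat.size s : ℝ) ≤ L + 1 := by
  have h1 : 0 < Nat.size s := Nat.size_pos.2 hs
  have h2 : 2 ^ (Nat.size s - 1) ≤ s := Nat.lt_size.1 (by omega)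
  have h3 : ((2 : ℝ) ^ ((Nat.size s - 1 : ℕ) : ℝ)) < 2 ^ L := by
    rw [Real.rpow_natCast]
    exact lt_of_le_of_lt (by exact_mod_cast h2) h
  have h4 := (Real.rpow_lt_rpow_left_iff one_lt_two).1 h3
  rw [Nat.cast_sub h1] at h4
  push_cast at h4
  linarith

/-- The lower bound for majority circuits computing a function that becomes `U_{k,n}` after a
substitution of variables and constants. -/
theorem exists_size_lower_bound (d : ℕ) (hd : 1 ≤ d) : ∃ (δ : ℝ) (K n₀ : ℕ), 0 < δ ∧
    ∀ (n k : ℕ) (ι : Type) (τ : ι → MonotoneInput (Fin k × Fin n)) (f : (ι → Bool) → Bool)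
      (C : MajorityCircuit ι), n₀ ≤ n → K ≤ k →
      (∀ x, f (fun i => (τ i).value x) = addThreshold k n x) → C.depth ≤ d → C.Computes f →
      (2 : ℝ) ^ (δ * (n : ℝ) ^ (1 / (d : ℝ))) ≤ C.size := by
  obtain ⟨e, rfl⟩ : ∃ e, d = e + 1 := ⟨d - 1, by omega⟩
  obtain ⟨c, hc, hcol⟩ := exists_foolingColumns_le e
  have hc1 : (1 : ℝ) ≤ c := by exact_mod_cast hc
  have h9 : (1 : ℝ) ≤ 9 ^ e := one_le_pow₀ (by norm_num)
  have htend : Tendsto (fun n : ℕ => (n : ℝ) ^ (1 / ((e + 1 : ℕ) : ℝ))) atTop atTop :=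
    (tendsto_rpow_atTop (by positivity)).comp tendsto_natCast_atTop_atTop
  obtain ⟨n₀, hn₀⟩ := eventually_atTop.1 (htend.eventually_gt_atTop (4 * c * 9 ^ e : ℝ))
  refine ⟨1 / (4 * c * 9 ^ e), foolingRows e, n₀, by positivity, ?_⟩
  intro n k ι τ f C hn hk hf hdepth hcomp
  have hX := hn₀ n hn
  set X : ℝ := (n : ℝ) ^ (1 / ((e + 1 : ℕ) : ℝ)) with hXdef
  have hXpow : X ^ (e + 1) = n := by
    rw [hXdef, ← Real.rpow_natCast, ← Real.rpow_mul (Nat.cast_nonneg n), one_div,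
      inv_mul_cancel₀ (by positivity), Real.rpow_one]
  have hXpos : 0 < X := lt_trans (by positivity) hX
  by_contra! hlt
  -- Fan-in at least one is needed to pad shallow subformulas to full depth.
  set s := max C.size 1 with hs
  have hs1 : 1 ≤ s := le_max_right _ _
  have hslt : (s : ℝ) < 2 ^ (1 / (4 * c * 9 ^ e) * X) := by
    rw [hs, Nat.cast_max]
    refine max_lt hlt ?_
    rw [Nat.cast_one]
    exact Real.one_lt_rpow one_lt_two (by positivity)
  have hsize := Nat.size_le_of_lt_two_rpow hs1 hslt
  -- The number of blocks per level: small enough for `c * m ^ (e + 1) ≤ n`, and larger than `X / (2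
  -- * c)`, which exceeds `9 ^ e * Nat.size s`.
  set m := ⌊X / c⌋₊ with hm
  have hXc : 4 * 9 ^ e < X / c := by
    rw [lt_div_iff₀ (by positivity)]
    linarith
  have hm1 : X / c < m + 1 := Nat.lt_floor_add_one _
  have hm2 : (m : ℝ) ≤ X / c := Nat.floor_le (by positivity)
  have hmlow : X / c < 2 * m := by linarith
  have hmpos : (0 : ℝ) < m := by linarith
  have hcols : foolingColumns m e ≤ n := by
    refine (hcol m).trans ?_
    have h1 : (c : ℝ) * m ^ (e + 1) ≤ n := by
      calc (c : ℝ) * m ^ (e + 1) ≤ c * (X / c) ^ (e + 1) := by gcongr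
        _ = X ^ (e + 1) / c ^ e := by
          rw [div_pow, pow_succ (c : ℝ)]
          field_simp
        _ ≤ X ^ (e + 1) := div_le_self (by positivity) (one_le_pow₀ hc1)
        _ = n := hXpow
    exact_mod_cast h1
  obtain ⟨ε, hε, hpair⟩ := hasFoolingPair s m e (by exact_mod_cast hmpos)
  have hε1 : ε < 1 := by
    refine hε.trans_lt ?_
    rw [← mul_div_assoc, div_lt_one hmpos]
    have h1 : (9 : ℝ) ^ e * Nat.size s ≤ 9 ^ e * (1 / (4 * c * 9 ^ e) * X + 1) := by gcongr
    have h2 : (9 : ℝ) ^ e * (1 / (4 * c * 9 ^ e) * X + 1) = X / c / 4 + 9 ^ e := by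
      field_simp
    linarith
  refine not_mem_thresholdClass_of_hasFoolingPair hpair hε1 hk hcols ?_
  have h1 := ThresholdClass.mono hs1 hdepth
    (C.value_mem_thresholdClass hs1 (le_max_left _ _) C.output)
  have h2 := ThresholdClass.subst h1 τ
  convert h2 using 1
  funext x
  rw [← hf]
  exact (hcomp _).symm

/-! ### Deficits and their local reconstruction. -/

/-- The number with the `m` (possibly large) binary digits `σ 0, …, σ (m - 1)`. -/
def digitSum (σ : ℕ → ℕ) : ℕ → ℕ
  | 0 => 0
  | m + 1 => 2 * digitSum σ m + σ m

theorem digitSum_congr {σ τ : ℕ → ℕ} {m : ℕ} (h : ∀ c < m, σ c = τ c) :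
    digitSum σ m = digitSum τ m := by
  induction m with
  | zero => rfl
  | succ m ih => rw [digitSum, digitSum, ih fun c hc => h c (by omega), h m (by omega)]

theorem digitSum_eq_sum (σ : ℕ → ℕ) (m : ℕ) :
    digitSum σ m = ∑ j : Fin m, 2 ^ (m - (j.val + 1)) * σ j := by
  induction m with
  | zero => rfl
  | succ m ih =>
    rw [digitSum, ih, Fin.sum_univ_castSucc, Finset.mul_sum]
    congr 1
    · refine Finset.sum_congr rfl fun j _ => ?_
      rw [← mul_assoc, ← pow_succ']
      congr 2
      have := j.isLt
      simp only [Fin.val_castSucc]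
      omega
    · simp

/-- The deficit after reading the digits `σ 0, …, σ (i - 1)`, starting from a deficit of `1`. -/
def deficit (σ : ℕ → ℕ) : ℕ → ℤ
  | 0 => 1
  | i + 1 => 2 * deficit σ i - σ i

theorem deficit_add (σ : ℕ → ℕ) (i m : ℕ) :
    deficit σ (i + m) = 2 ^ m * deficit σ i - digitSum (fun c => σ (i + c)) m := by
  induction m with
  | zero => simp [digitSum]
  | succ m ih =>
    rw [← add_assoc, deficit, ih, digitSum, pow_succ]
    push_cast
    ring

theorem deficit_nonpos_of_le {σ : ℕ → ℕ} {i j : ℕ} (hij : i ≤ j) (h : deficit σ i ≤ 0) :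
    deficit σ j ≤ 0 := by
  induction j, hij using Nat.le_induction with
  | base => exact h
  | succ j _ ih =>
    rw [deficit]
    omega

/-- From `D ≥ k` the next deficit is at least `2 * D - k ≥ k`: later digits cannot catch up. -/
theorem le_deficit_of_le {σ : ℕ → ℕ} {k : ℕ} (hσ : ∀ i, σ i ≤ k) {i j : ℕ} (hij : i ≤ j)
    (h : (k : ℤ) ≤ deficit σ i) : (k : ℤ) ≤ deficit σ j := by
  induction j, hij using Nat.le_induction with
  | base => exact h
  | succ j _ ih =>
    have := hσ j
    rw [deficit]
    omega

/-- The only deficit from which reading `k` digits leads to a deficit in `(0, 2 ^ k)`. -/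
def guessDeficit (k : ℕ) (σ : ℕ → ℕ) : ℕ := digitSum σ k / 2 ^ k + 1

/-- With `S` the number formed by the next `k` digits, the later deficit is `2 ^ k * D - S`. If it
lies strictly between `0` and `2 ^ k`, then `S / 2 ^ k` rounds down to `D - 1`. -/
theorem guessDeficit_eq {σ : ℕ → ℕ} {k i : ℕ} (h1 : 0 < deficit σ (i + k))
    (h2 : deficit σ (i + k) < 2 ^ k) :
    (guessDeficit k fun c => σ (i + c) : ℤ) = deficit σ i := by
  rw [deficit_add] at h1 h2
  rw [guessDeficit]
  push_cast
  set S : ℤ := ((digitSum (fun c => σ (i + c)) k : ℕ) : ℤ)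
  have hp : (0 : ℤ) < 2 ^ k := by positivity
  have h3 : S / 2 ^ k = deficit σ i - 1 := by
    rw [Int.ediv_eq_iff_of_pos hp]
    constructor <;> linarith
  rw [h3]
  ring

/-- Is the guess for the next deficit consistent with the guess for the present one? -/
def GuessConsistent (k : ℕ) (σ : ℕ → ℕ) : Prop :=
  guessDeficit k (fun c => σ (1 + c)) + σ 0 = 2 * guessDeficit k σ

/-- Does the deficit vanish after `k + 1` more digits if the present guess is right? -/
def GuessVanishes (k : ℕ) (σ : ℕ → ℕ) : Prop :=
  2 ^ (k + 1) * guessDeficit k σ ≤ digitSum σ (k + 1)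

theorem guessDeficit_congr {k : ℕ} {σ τ : ℕ → ℕ} (h : ∀ c < k, σ c = τ c) :
    guessDeficit k σ = guessDeficit k τ := by
  rw [guessDeficit, guessDeficit, digitSum_congr h]

theorem guessConsistent_congr {k : ℕ} {σ τ : ℕ → ℕ} (h : ∀ c ≤ k, σ c = τ c) :
    GuessConsistent k σ ↔ GuessConsistent k τ := by
  rw [GuessConsistent, GuessConsistent, h 0 (Nat.zero_le _),
    guessDeficit_congr fun c hc => h c hc.le, guessDeficit_congr fun c hc => h (1 + c) (by omega)]

theorem guessVanishes_congr {k : ℕ} {σ τ : ℕ → ℕ} (h : ∀ c ≤ k, σ c = τ c) :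
    GuessVanishes k σ ↔ GuessVanishes k τ := by
  rw [GuessVanishes, GuessVanishes, guessDeficit_congr fun c hc => h c hc.le,
    digitSum_congr fun c hc => h c (Nat.le_of_lt_succ hc)]

theorem deficit_of_eq_one {σ : ℕ → ℕ} {m : ℕ} (h : ∀ c < m, σ c = 1) : deficit σ m = 1 := by
  induction m with
  | zero => rfl
  | succ m ih =>
    rw [deficit, ih fun c hc => h c (by omega), h m (by omega)]
    rfl

/-- The witness `a` lies `k + 1` places before the first vanishing, so the guesses up to `a` only
look at positive, small deficits. Conversely, the first guess is right because of the leading ones,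
and consistency propagates correctness up to `a`. -/
theorem deficit_nonpos_iff {σ : ℕ → ℕ} {k n : ℕ} (hk : 0 < k) (hσ : ∀ i, σ i ≤ k)
    (hone : ∀ i ≤ k, σ i = 1) :
    deficit σ (k + 1 + n) ≤ 0 ↔ ∃ a ≤ n, (∀ i < a, GuessConsistent k fun c => σ (i + c)) ∧
      GuessVanishes k fun c => σ (a + c) := by
  constructor
  · intro h
    have hex : ∃ t, deficit σ t ≤ 0 := ⟨_, h⟩
    classical
    have ht := Nat.find_spec hex
    have htmin : ∀ i < Nat.find hex, 0 < deficit σ i := fun i hi => not_le.1 (Nat.find_min hex hi)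
    have htle := Nat.find_min' hex h
    generalize Nat.find hex = t at ht htmin htle
    have htk : k + 1 < t := by
      by_contra! hlt
      rw [deficit_of_eq_one fun c hc => hone c (by omega)] at ht
      omega
    -- A deficit of `2 ^ k` or more exceeds `k` and could never vanish.
    have hlt : ∀ i < t, deficit σ i < 2 ^ k := by
      intro i hi
      by_contra! hge
      have h1 : (k : ℤ) < 2 ^ k := by exact_mod_cast Nat.lt_two_pow_self
      have := le_deficit_of_le hσ hi.le (h1.le.trans hge)
      omega
    obtain ⟨a, rfl⟩ : ∃ a, t = a + (k + 1) := ⟨t - (k + 1), by omega⟩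
    have hguess : ∀ i ≤ a, (guessDeficit k fun c => σ (i + c) : ℤ) = deficit σ i := fun i hi =>
      guessDeficit_eq (htmin _ (by omega)) (hlt _ (by omega))
    refine ⟨a, by omega, fun i hi => ?_, ?_⟩
    · have h1 := hguess i hi.le
      have h2 := hguess (i + 1) hi
      rw [deficit, ← h1] at h2
      simp only [GuessConsistent, add_zero]
      simp only [add_assoc] at h2
      omega
    · rw [deficit_add, ← hguess a le_rfl] at ht
      rw [GuessVanishes]
      zify
      linarith
  · rintro ⟨a, ha, hcons, hvan⟩
    have hguess : ∀ i ≤ a, (guessDeficit k fun c => σ (i + c) : ℤ) = deficit σ i := by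
      intro i hi
      induction i with
      | zero =>
        refine guessDeficit_eq ?_ ?_ <;> rw [deficit_of_eq_one fun c hc => hone c (by omega)]
        · exact one_pos
        · exact_mod_cast Nat.one_lt_two_pow hk.ne'
      | succ i ih =>
        have h1 := ih (by omega)
        have h2 := hcons i (by omega)
        simp only [GuessConsistent, add_zero, ← add_assoc] at h2
        rw [deficit, ← h1]
        omega
    refine deficit_nonpos_of_le (i := a + (k + 1)) (by omega) ?_
    rw [deficit_add, ← hguess a le_rfl]
    rw [GuessVanishes] at hvan
    zify at hvan
    linarith

/-! ### Circuits of depth three. -/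

theorem exists_depth_three_circuit_fin {ι : Type} {a b j : ℕ} (M : ℕ)
    (lit : Fin a → LiteralInput ι) (clause : Fin b → List (Fin a)) (term : Fin j → List (Fin b))
    (hclause : ∀ c, (clause c).length ≤ M) (hterm : ∀ t, (term t).length ≤ M) (hj : j ≤ M) :
    ∃ C : AndOrNotCircuit ι,
      (∀ x, C.value (LiteralInput.value x) AndOrGate.op C.output = true ↔
        ∃ t, ∀ c ∈ term t, ∃ l ∈ clause c, (lit l).value x = true) ∧
      C.depth ≤ 3 ∧ C.numNodes = a + b + j + 1 ∧ C.size ≤ (a + b + j + 1) * M := by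
  let C : AndOrNotCircuit ι :=
    { numNodes := a + b + j + 1
      node := fun v =>
        if h1 : v.val < a then .input (lit ⟨v, h1⟩)
        else if h2 : v.val < a + b then
          .gate .or ((clause ⟨v - a, by omega⟩).map fun l : Fin a => ⟨l, by omega⟩)
        else if h3 : v.val < a + b + j then
          .gate .and ((term ⟨v - (a + b), by omega⟩).map fun c : Fin b => ⟨a + c, by omega⟩)
        else .gate .or ((List.finRange j).map fun t : Fin j => ⟨a + b + t, by omega⟩)
      output := ⟨a + b + j, by omega⟩ }
  have node_lit : ∀ l : Fin a, C.node ⟨l, by simp only [C]; omega⟩ = .input (lit l) := by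
    intro l
    simp [C]
  have node_clause : ∀ c : Fin b, C.node ⟨a + c, by simp only [C]; omega⟩ =
      .gate .or ((clause c).map fun l : Fin a => ⟨l, by simp only; omega⟩) := by
    intro c
    simp only [C]
    rw [dif_neg (by omega), dif_pos (by omega)]
    simp
  have node_term : ∀ t : Fin j, C.node ⟨a + b + t, by simp only [C]; omega⟩ =
      .gate .and ((term t).map fun c : Fin b => ⟨a + c, by simp only; omega⟩) := by
    intro t
    simp only [C]
    rw [dif_neg (by omega), dif_neg (by omega), dif_pos (by omega)]
    simp
  have node_output : C.node C.output =
      .gate .or ((List.finRange j).map fun t : Fin j => ⟨a + b + t, by simp only [C]; omega⟩) := by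
    simp only [C]
    rw [dif_neg (by omega), dif_neg (by omega), dif_neg (by omega)]
  refine ⟨C, fun x => ?_, ?_, rfl, ?_⟩
  · have value_lit : ∀ l : Fin a, C.value (LiteralInput.value x) AndOrGate.op
        ⟨l, by simp only [C]; omega⟩ = (lit l).value x := by
      intro l
      rw [Circuit.value, node_lit]
    have value_clause : ∀ c : Fin b, C.value (LiteralInput.value x) AndOrGate.op
        ⟨a + c, by simp only [C]; omega⟩ = (clause c).any fun l => (lit l).value x := by
      intro c
      rw [Circuit.value, node_clause]
      simp [AndOrGate.op, Function.comp_def, value_lit]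
    have value_term : ∀ t : Fin j, C.value (LiteralInput.value x) AndOrGate.op
        ⟨a + b + t, by simp only [C]; omega⟩ =
          (term t).all fun c => (clause c).any fun l => (lit l).value x := by
      intro t
      rw [Circuit.value, node_term]
      simp [AndOrGate.op, Function.comp_def, value_clause]
    rw [Circuit.value, node_output]
    simp [AndOrGate.op, Function.comp_def, value_term]
  · have depth_lit : ∀ l : Fin a, C.nodeDepth ⟨l, by simp only [C]; omega⟩ = 0 := by
      intro l
      rw [Circuit.nodeDepth, node_lit]
    have foldr_le : ∀ (l : List ℕ) (m : ℕ), (∀ i ∈ l, i ≤ m) → l.foldr max 0 ≤ m :=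
      fun l m h => List.max_le_of_forall_le l m h
    have depth_clause : ∀ c : Fin b, C.nodeDepth ⟨a + c, by simp only [C]; omega⟩ ≤ 1 := by
      intro c
      rw [Circuit.nodeDepth, node_clause]
      refine Nat.succ_le_succ (foldr_le _ _ ?_)
      simp [depth_lit]
    have depth_term : ∀ t : Fin j, C.nodeDepth ⟨a + b + t, by simp only [C]; omega⟩ ≤ 2 := by
      intro t
      rw [Circuit.nodeDepth, node_term]
      refine Nat.succ_le_succ (foldr_le _ _ ?_)
      simp only [List.map_map, List.mem_map, Function.comp_def, forall_exists_index, and_imp,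
        forall_apply_eq_imp_iff₂]
      exact fun c _ => depth_clause c
    rw [Circuit.depth, Circuit.nodeDepth, node_output]
    refine Nat.succ_le_succ (foldr_le _ _ ?_)
    simp only [List.map_map, List.mem_map, Function.comp_def, forall_exists_index, and_imp,
      forall_apply_eq_imp_iff₂]
    exact fun t _ => depth_term t
  · have hdeg : ∀ v, C.inDegree v ≤ M := by
      intro v
      simp only [Circuit.inDegree, C]
      split_ifs with h1 h2 h3
      · exact Nat.zero_le _
      · simpa using hclause _
      · simpa using hterm _
      · simpa using hj
    refine (Finset.sum_le_sum fun v _ => hdeg v).trans (le_of_eq ?_)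
    simp [C]

/-- A disjunction of conjunctions of disjunctions of literals as a circuit of depth three. -/
theorem exists_depth_three_circuit {ι L B J : Type} [Fintype L] [Fintype B] [Fintype J] (M : ℕ)
    (lit : L → LiteralInput ι) (clause : B → List L) (term : J → List B)
    (hclause : ∀ c, (clause c).length ≤ M) (hterm : ∀ t, (term t).length ≤ M)
    (hj : Fintype.card J ≤ M) :
    ∃ C : AndOrNotCircuit ι,
      (∀ x, C.value (LiteralInput.value x) AndOrGate.op C.output = true ↔
        ∃ t, ∀ c ∈ term t, ∃ l ∈ clause c, (lit l).value x = true) ∧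
      C.depth ≤ 3 ∧ C.numNodes = Fintype.card L + Fintype.card B + Fintype.card J + 1 ∧
      C.size ≤ (Fintype.card L + Fintype.card B + Fintype.card J + 1) * M := by
  let eL := Fintype.equivFin L
  let eB := Fintype.equivFin B
  let eJ := Fintype.equivFin J
  obtain ⟨C, hC, hrest⟩ := exists_depth_three_circuit_fin M (fun l => lit (eL.symm l))
    (fun c => (clause (eB.symm c)).map eL) (fun t => (term (eJ.symm t)).map eB)
    (by simpa using fun c => hclause (eB.symm c)) (by simpa using fun t => hterm (eJ.symm t)) hj
  refine ⟨C, fun x => (hC x).trans ?_, hrest⟩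
  rw [← eJ.symm.exists_congr_right]
  simp

/-- The bits of column `i - (k + 1)` of `x`, all `0` where there is no such column. -/
def shiftedColumn {k n : ℕ} (x : Fin k × Fin n → Bool) (i : ℕ) (r : Fin k) : Bool :=
  if h : k + 1 ≤ i ∧ i - (k + 1) < n then x (r, ⟨i - (k + 1), h.2⟩) else false

/-- The digits of the number `rowSum x`, after `k + 1` additional digits `1`. -/
def paddedDigit {k n : ℕ} (x : Fin k × Fin n → Bool) (i : ℕ) : ℕ :=
  if i ≤ k then 1 else ∑ r, (shiftedColumn x i r).toNat

/-- The digits at the positions from `i` to `i + k`, given the bits of these columns. -/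
def windowDigit {k : ℕ} (i : ℕ) (α : Fin k × Fin (k + 1) → Bool) (c : ℕ) : ℕ :=
  if i + c ≤ k then 1 else if h : c < k + 1 then ∑ r, (α (r, ⟨c, h⟩)).toNat else 0

theorem windowDigit_eq {k n : ℕ} (x : Fin k × Fin n → Bool) (i c : ℕ) (hc : c ≤ k) :
    windowDigit i (fun p => shiftedColumn x (i + p.2) p.1) c = paddedDigit x (i + c) := by
  unfold windowDigit paddedDigit
  rw [dif_pos (Nat.lt_succ_of_le hc)]

theorem addThreshold_eq_true_iff {k n : ℕ} (hk : 0 < k) (x : Fin k × Fin n → Bool) :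
    addThreshold k n x = true ↔ ∃ a : Fin (n + 1),
      (∀ i : Fin (n + 1), i < a → GuessConsistent k
        (windowDigit i fun p => shiftedColumn x (i + p.2) p.1)) ∧
      GuessVanishes k (windowDigit a fun p => shiftedColumn x (a + p.2) p.1) := by
  have hle : ∀ i, paddedDigit x i ≤ k := by
    intro i
    unfold paddedDigit
    split_ifs
    · exact hk
    · exact (Finset.sum_le_sum fun r _ => Bool.toNat_le _).trans (by simp)
  have hone : ∀ i ≤ k, paddedDigit x i = 1 := fun i hi => if_pos hi
  have hdef : deficit (paddedDigit x) (k + 1 + n) = 2 ^ n - rowSum x := by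
    rw [deficit_add, deficit_of_eq_one fun c hc => hone c (Nat.le_of_lt_succ hc), mul_one,
      digitSum_eq_sum]
    congr 2
    refine Finset.sum_congr rfl fun j _ => ?_
    congr 1
    rw [paddedDigit, if_neg (by omega)]
    refine Finset.sum_congr rfl fun r _ => ?_
    simp [shiftedColumn]
  have hiff := deficit_nonpos_iff (n := n) hk hle hone
  rw [hdef, sub_nonpos] at hiff
  have hpow : 2 ^ n ≤ rowSum x ↔ (2 : ℤ) ^ n ≤ rowSum x := by
    zify
  have hcons : ∀ i, (GuessConsistent k fun c => paddedDigit x (i + c)) ↔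
      GuessConsistent k (windowDigit i fun p => shiftedColumn x (i + p.2) p.1) := fun i =>
    guessConsistent_congr fun c hc => (windowDigit_eq x i c hc).symm
  have hvan : ∀ i, (GuessVanishes k fun c => paddedDigit x (i + c)) ↔
      GuessVanishes k (windowDigit i fun p => shiftedColumn x (i + p.2) p.1) := fun i =>
    guessVanishes_congr fun c hc => (windowDigit_eq x i c hc).symm
  rw [addThreshold, decide_eq_true_eq, hpow, hiff]
  simp only [hcons, hvan]
  constructor
  · rintro ⟨a, ha, h1, h2⟩
    exact ⟨⟨a, Nat.lt_succ_of_le ha⟩, fun i hi => h1 i hi, h2⟩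
  · rintro ⟨a, h1, h2⟩
    exact ⟨a, Nat.le_of_lt_succ a.isLt, fun i hi => h1 ⟨i, hi.trans a.isLt⟩ hi, h2⟩

/-- The literals of the circuit: constants, variables and negated variables. -/
def depthThreeLiteral {k n : ℕ} {ι : Type} (ρ : Fin k × Fin n → ι) :
    Bool ⊕ Bool × (Fin k × Fin n) → LiteralInput ι
  | .inl b => .const b
  | .inr (false, v) => .pos (ρ v)
  | .inr (true, v) => .neg (ρ v)

/-- The literal that says that a bit of a shifted column differs from `b`. -/
def mismatchLiteral {k n : ℕ} (i : ℕ) (r : Fin k) (b : Bool) : Bool ⊕ Bool × (Fin k × Fin n) :=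
  if h : k + 1 ≤ i ∧ i - (k + 1) < n then .inr (b, (r, ⟨i - (k + 1), h.2⟩)) else .inl b

theorem mismatchLiteral_value {k n : ℕ} {ι : Type} (ρ : Fin k × Fin n → ι) (x : ι → Bool) (i : ℕ)
    (r : Fin k) (b : Bool) : (depthThreeLiteral ρ (mismatchLiteral i r b)).value x = true ↔
      shiftedColumn (fun q => x (ρ q)) i r ≠ b := by
  unfold mismatchLiteral shiftedColumn
  split_ifs with h
  · cases b <;> simp [depthThreeLiteral, LiteralInput.value]
  · cases b <;> simp [depthThreeLiteral, LiteralInput.value]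

/-- A clause is indexed by a position and a bit pattern of `k + 1` columns and says that the actual
window differs from this pattern. The term for `a` excludes every pattern that violates its local
check, so the check's conjunction of clauses merges with the conjunction over positions. -/
theorem exists_andOrNotCircuit (k n : ℕ) {ι : Type} (ρ : Fin k × Fin n → ι) :
    ∃ C : AndOrNotCircuit ι, C.Computes (fun x => addThreshold k n fun q => x (ρ q)) ∧
      C.depth ≤ 3 ∧
      C.numNodes ≤ 2 + 2 * (k * n) + (n + 1) * 2 ^ (k * (k + 1)) + (n + 1) + 1 ∧
      C.size ≤ (2 + 2 * (k * n) + (n + 1) * 2 ^ (k * (k + 1)) + (n + 1) + 1) *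
        ((n + 1) * 2 ^ (k * (k + 1)) + k * (k + 1) + (n + 1)) := by
  classical
  -- Without rows the function is constantly `0`, the empty disjunction; the deficit criterion needs
  -- `k > 0`.
  rcases Nat.eq_zero_or_pos k with rfl | hk
  · obtain ⟨C, hC, hdepth, hnodes, hsize⟩ := exists_depth_three_circuit (L := Empty) (B := Empty)
      (J := Empty) 0 (fun l => nomatch l : Empty → LiteralInput ι) (fun c => nomatch c)
      (fun t => nomatch t) (fun c => nomatch c) (fun t => nomatch t) (by simp)
    refine ⟨C, fun x => ?_, hdepth, by rw [hnodes]; simp, hsize.trans (by simp)⟩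
    have h1 : rowSum (fun q : Fin 0 × Fin n => x (ρ q)) = 0 := by simp [rowSum]
    rw [Bool.eq_iff_iff, hC x]
    simp [addThreshold, h1]
  let B : Type := Fin (n + 1) × (Fin k × Fin (k + 1) → Bool)
  let clause : B → List (Bool ⊕ Bool × (Fin k × Fin n)) := fun c =>
    Finset.univ.toList.map fun p : Fin k × Fin (k + 1) =>
      mismatchLiteral (c.1 + p.2) p.1 (c.2 p)
  let term : Fin (n + 1) → List B := fun a =>
    (Finset.univ.filter fun c : B => (c.1 < a ∧ ¬ GuessConsistent k (windowDigit c.1 c.2)) ∨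
      (c.1 = a ∧ ¬ GuessVanishes k (windowDigit c.1 c.2))).toList
  have hB : Fintype.card B = (n + 1) * 2 ^ (k * (k + 1)) := by
    simp [B]
  have hL : Fintype.card (Bool ⊕ Bool × (Fin k × Fin n)) = 2 + 2 * (k * n) := by
    simp
  obtain ⟨C, hC, hdepth, hnodes, hsize⟩ := exists_depth_three_circuit
    ((n + 1) * 2 ^ (k * (k + 1)) + k * (k + 1) + (n + 1)) (depthThreeLiteral ρ) clause term
    (fun c => by
      have : (clause c).length = k * (k + 1) := by simp [clause]
      omega)
    (fun t => by
      have : (term t).length ≤ Fintype.card B := by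
        simp only [term, Finset.length_toList]
        exact Finset.card_le_univ _
      omega)
    (by
      rw [Fintype.card_fin]
      omega)
  rw [hB, hL, Fintype.card_fin] at hnodes hsize
  refine ⟨C, fun x => ?_, hdepth, hnodes.le, hsize⟩
  have hclause : ∀ c : B, (∃ l ∈ clause c, (depthThreeLiteral ρ l).value x = true) ↔
      (fun p : Fin k × Fin (k + 1) => shiftedColumn (fun q => x (ρ q)) (c.1 + p.2) p.1) ≠ c.2 := by
    intro c
    simp only [clause, List.mem_map, Finset.mem_toList, Finset.mem_univ, true_and,
      exists_exists_eq_and, mismatchLiteral_value, ne_eq, funext_iff, not_forall]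
  rw [Bool.eq_iff_iff, hC x, addThreshold_eq_true_iff hk]
  refine exists_congr fun a => ?_
  simp only [hclause]
  simp only [term, Finset.mem_toList, Finset.mem_filter, Finset.mem_univ, true_and]
  constructor
  · intro h
    refine ⟨fun i hi => ?_, ?_⟩
    · by_contra hcons
      exact h (i, _) (Or.inl ⟨hi, hcons⟩) rfl
    · by_contra hvan
      exact h (a, _) (Or.inr ⟨rfl, hvan⟩) rfl
  · rintro ⟨h1, h2⟩ c hc heq
    rw [← heq] at hc
    rcases hc with ⟨hi, hc⟩ | ⟨hi, hc⟩
    · exact hc (h1 c.1 hi)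
    · rw [hi] at hc
      exact hc h2

/-! ### The exponent one half, and the conclusion. -/

theorem numRows_le_self (n : ℕ) : numRows (1 / 2) n ≤ n :=
  (numRows_le (by norm_num) (by norm_num) n).trans (Nat.log_le_self 2 n)

/-- The choice of `1 / 2` gives `k ^ 2 ≤ log₂ n`, so the number of window patterns is polynomial.
The added `1` covers `n = 0`. -/
theorem two_pow_numRows_le (n : ℕ) :
    2 ^ (numRows (1 / 2) n * (numRows (1 / 2) n + 1)) ≤ n ^ 2 + 1 := by
  set k := numRows (1 / 2) n with hk
  rcases Nat.eq_zero_or_pos n with rfl | hn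
  · have : k = 0 := Nat.le_zero.1 (numRows_le_self 0)
    simp [this]
  have hlog : 0 ≤ Real.logb 2 n := Real.logb_nonneg one_lt_two (by exact_mod_cast hn)
  have h1 : (k : ℝ) ≤ (Real.logb 2 n) ^ (1 / 2 : ℝ) := Nat.floor_le (by positivity)
  have h2 : (k : ℝ) ^ 2 ≤ Real.logb 2 n := by
    calc (k : ℝ) ^ 2 ≤ ((Real.logb 2 n) ^ (1 / 2 : ℝ)) ^ 2 := by gcongr
      _ = Real.logb 2 n := by
        rw [← Real.sqrt_eq_rpow, Real.sq_sqrt hlog]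
  have h3 : 2 ^ k ^ 2 ≤ n := by
    have h4 : (2 : ℝ) ^ ((k ^ 2 : ℕ) : ℝ) ≤ n := by
      rw [← Real.le_logb_iff_rpow_le one_lt_two (by exact_mod_cast hn)]
      exact_mod_cast h2
    rw [Real.rpow_natCast] at h4
    exact_mod_cast h4
  calc 2 ^ (k * (k + 1)) ≤ 2 ^ (k ^ 2 * 2) :=
        Nat.pow_le_pow_right two_pos (by nlinarith [Nat.le_self_pow two_ne_zero k])
    _ = (2 ^ k ^ 2) ^ 2 := pow_mul _ _ _
    _ ≤ n ^ 2 := Nat.pow_le_pow_left h3 2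
    _ ≤ n ^ 2 + 1 := Nat.le_succ _

/-- A polynomial bound for the number of nodes and wires of the circuits of depth three. -/
noncomputable def depthThreeSizeBound : Polynomial ℕ :=
  (2 + 2 * Polynomial.X ^ 2 + (Polynomial.X + 1) * (Polynomial.X ^ 2 + 1) + (Polynomial.X + 1) + 1) *
    ((Polynomial.X + 1) * (Polynomial.X ^ 2 + 1) + (Polynomial.X ^ 2 + 1) + (Polynomial.X + 1))

theorem exists_andOrNotCircuit_numRows (n : ℕ) {ι : Type} (ρ : Fin (numRows (1 / 2) n) × Fin n → ι) :
    ∃ C : AndOrNotCircuit ι,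
      C.Computes (fun x => addThreshold (numRows (1 / 2) n) n fun q => x (ρ q)) ∧ C.depth ≤ 3 ∧
        C.numNodes ≤ depthThreeSizeBound.eval n ∧ C.size ≤ depthThreeSizeBound.eval n := by
  obtain ⟨C, hC, hdepth, hnodes, hsize⟩ := exists_andOrNotCircuit _ n ρ
  have h1 := two_pow_numRows_le n
  have h2 := numRows_le_self n
  set k := numRows (1 / 2) n
  have h3 : k * (k + 1) < 2 ^ (k * (k + 1)) := Nat.lt_two_pow_self
  have h4 : k * n ≤ n ^ 2 := by nlinarith
  have h5 : 2 + 2 * (k * n) + (n + 1) * 2 ^ (k * (k + 1)) + (n + 1) + 1 ≤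
      2 + 2 * n ^ 2 + (n + 1) * (n ^ 2 + 1) + (n + 1) + 1 := by gcongr
  have h6 : (n + 1) * 2 ^ (k * (k + 1)) + k * (k + 1) + (n + 1) ≤
      (n + 1) * (n ^ 2 + 1) + (n ^ 2 + 1) + (n + 1) := by
    gcongr
    exact h3.le.trans h1
  have heval : depthThreeSizeBound.eval n =
      (2 + 2 * n ^ 2 + (n + 1) * (n ^ 2 + 1) + (n + 1) + 1) *
        ((n + 1) * (n ^ 2 + 1) + (n ^ 2 + 1) + (n + 1)) := by
    simp [depthThreeSizeBound]
  refine ⟨C, hC, hdepth, ?_, ?_⟩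
  · rw [heval]
    refine (hnodes.trans h5).trans (Nat.le_mul_of_pos_right _ (by positivity))
  · rw [heval]
    exact hsize.trans (Nat.mul_le_mul h5 h6)

theorem addThreshold_monotone (k N : ℕ) : Monotone (addThreshold k N) := by
  intro x y hxy
  have h : rowSum x ≤ rowSum y := by
    rw [rowSum_eq_sum, rowSum_eq_sum]
    refine Finset.sum_le_sum fun p _ => Nat.mul_le_mul_left _ ?_
    have := hxy p
    revert this
    cases x p <;> cases y p <;> simp
  intro h1
  simp only [addThreshold, decide_eq_true_eq] at h1 ⊢
  omega

theorem eventually_le_numRows (K : ℕ) : ∀ᶠ n : ℕ in atTop, K ≤ numRows (1 / 2) n := by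
  have h : Tendsto (fun n : ℕ => (Real.logb 2 n) ^ (1 / 2 : ℝ)) atTop atTop :=
    (tendsto_rpow_atTop (by norm_num)).comp
      ((Real.tendsto_logb_atTop one_lt_two).comp tendsto_natCast_atTop_atTop)
  filter_upwards [h.eventually_ge_atTop (K : ℝ)] with n hn
  exact Nat.le_floor hn

theorem theorem3 :
    ∃ (c : ℝ) (hc0 : 0 < c) (hc1 : c < 1),
      -- the functions `U_{k,n}` themselves, with `k = ⌊(log₂ n) ^ c⌋`
      ((∀ n : ℕ, Monotone (addThreshold (numRows c n) n)) ∧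
        (∃ p : Polynomial ℕ, ∀ n : ℕ,
          ∃ C : AndOrNotCircuit (Fin (numRows c n) × Fin n),
            C.Computes (addThreshold (numRows c n) n) ∧ C.depth ≤ 3 ∧
              C.numNodes ≤ p.eval n ∧ C.size ≤ p.eval n) ∧
        (∀ d : ℕ, 2 ≤ d → ∃ δ : ℝ, 0 < δ ∧ ∀ᶠ n : ℕ in atTop,
          ∀ C : MajorityCircuit (Fin (numRows c n) × Fin n),
            C.depth ≤ d → C.Computes (addThreshold (numRows c n) n) →
              (2 : ℝ) ^ (δ * (n : ℝ) ^ (1 / (d : ℝ))) ≤ C.size)) ∧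
      -- the same functions, regarded as functions of `n * ⌊log₂ n⌋` variables
      ((∀ n : ℕ, Monotone (paddedAddThreshold hc0 hc1 n)) ∧
        (∃ p : Polynomial ℕ, ∀ n : ℕ,
          ∃ C : AndOrNotCircuit (Fin (Nat.log 2 n) × Fin n),
            C.Computes (paddedAddThreshold hc0 hc1 n) ∧ C.depth ≤ 3 ∧
              C.numNodes ≤ p.eval n ∧ C.size ≤ p.eval n) ∧
        (∀ d : ℕ, 2 ≤ d → ∃ δ : ℝ, 0 < δ ∧ ∀ᶠ n : ℕ in atTop,
          ∀ C : MajorityCircuit (Fin (Nat.log 2 n) × Fin n),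
            C.depth ≤ d → C.Computes (paddedAddThreshold hc0 hc1 n) →
              (2 : ℝ) ^ (δ * (n : ℝ) ^ (1 / (d : ℝ))) ≤ C.size)) := by

  have hc0 : (0 : ℝ) < 1 / 2 := by norm_num
  have hc1 : (1 / 2 : ℝ) < 1 := by norm_num
  refine ⟨1 / 2, hc0, hc1, ⟨fun n => addThreshold_monotone _ n,
    ⟨depthThreeSizeBound, fun n => exists_andOrNotCircuit_numRows n id⟩, fun d hd => ?_⟩,
    fun n x y hxy => addThreshold_monotone _ n fun q => hxy _,
    ⟨depthThreeSizeBound, fun n => exists_andOrNotCircuit_numRows n _⟩, fun d hd => ?_⟩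
  · obtain ⟨δ, K, n₀, hδ, h⟩ := exists_size_lower_bound d (by omega)
    refine ⟨δ, hδ, ?_⟩
    filter_upwards [eventually_ge_atTop n₀, eventually_le_numRows K] with n hn hK C hdepth hC
    exact h n _ _ MonotoneInput.var _ C hn hK (fun _ => rfl) hdepth hC
  · obtain ⟨δ, K, n₀, hδ, h⟩ := exists_size_lower_bound d (by omega)
    refine ⟨δ, hδ, ?_⟩
    filter_upwards [eventually_ge_atTop n₀, eventually_le_numRows K] with n hn hK C hdepth hC
    -- The ignored rows are set to `0`, which restricts the padded function to the original one.
    refine h n _ _ (fun q => if hq : q.1.val < numRows (1 / 2) n then .var (⟨q.1, hq⟩, q.2)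
      else .const false) _ C hn hK (fun x => ?_) hdepth hC
    rw [paddedAddThreshold]
    congr 1
    funext q
    exact congrArg (MonotoneInput.value x) (dif_pos q.1.isLt)
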